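/- Let $d,m\ge 1$ be integers and $\epsilon>0$. There is a constant $C$, depending only on $\epsilon$, $d$ and $m$, such that the following holds. Let $\mathcal H$ be a Hilbert space of dimension $d$, let $\rho$ be a density operator on $\mathcal H$ with $\rho>0$ (for instance the average state $\sum_i p_i|\psi_i\rangle\langle\psi_i|$ of an ensemble spanning $\mathcal H$), and let $\mathbf a=(a_j)_{j=1,\dots,m}$ be a POVM on $\mathcal H$, i.e. $a_j\ge 0$ and $\sum_j a_j=\mathbb 1$. Put $$\lambda_j=\operatorname{Tr}(\rho a_j),\qquad \hat\rho_j=\frac{1}{\lambda_j}\sqrt\rho\,a_j\sqrt\rho ,$$ and let $H(\sigma)=-\operatorname{Tr}\sigma\log\sigma$ denote the von Neumann entropy (terms with $\lambda_j=0$ are omitted from the sum below). Then for every $l$ there is a POVM $\mathbf A=(A_\mu)_{\mu=1,\dots,M}$ on $\mathcal H^{\otimes l}$, whose outcomes $\mu$ are labelled by words $j^l_\mu=(j_{\mu 1},\dots,j_{\mu l})\in\{1,\dots,m\}^l$, with $$M\le\exp\Bigl(l\Bigl(H(\rho)-\sum_j\lambda_jH(\hat\rho_j)\Bigr)+C\sqrt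 l\Bigr)$$ outcomes, such that its marginals $$A^{(k)}_j=\operatorname{Tr}_{\neq k}\Bigl(\bigl(\rho^{\otimes[l]\setminus k}\otimes\mathbb 1_k\bigr)\sum_{\mu:\ j_{\mu k}=j}A_\mu\Bigr)$$ ($\operatorname{Tr}_{\ne k}$ being the partial trace over all tensor factors but the $k$-th) satisfy, in the operator norm, $$\sum_{j=1}^m\|A^{(k)}_j-a_j\|\le\epsilon\qquad\text{for every }k=1,\dots,l .$$ -/

import Mathlib

open scoped ComplexOrder

noncomputable section

namespace POVMCompression

/-- A density operator of full rank: `ρ > 0` and `Tr ρ = 1`. -/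
structure IsFaithfulState {n : Type} [Fintype n] (ρ : Matrix n n ℂ) : Prop where
  posDef : ρ.PosDef
  trace_eq_one : ρ.trace = 1

/-- A POVM with outcome set `ι`. -/
structure IsPOVM {ι n : Type} [Fintype ι] [Fintype n] [DecidableEq n]
    (a : ι → Matrix n n ℂ) : Prop where
  posSemidef : ∀ j, (a j).PosSemidef
  sum_eq_one : ∑ j, a j = 1

/-- The von Neumann entropy `-Tr (ρ log ρ)` (natural logarithm, `0 log 0 = 0`). -/
def entropy {n : Type} [Fintype n] [DecidableEq n] (ρ : Matrix n n ℂ) : ℝ :=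
  (cfc Real.negMulLog ρ).trace.re

/-- The outcome probability `λ_j = Tr (ρ a_j)`. -/
def outcomeProb {ι n : Type} [Fintype n] (ρ : Matrix n n ℂ) (a : ι → Matrix n n ℂ) (j : ι) : ℝ :=
  (ρ * a j).trace.re

/-- The state `√ρ a_j √ρ / λ_j` of the canonical ensemble. If `λ_j = 0` this is the zero matrix,
which only ever enters multiplied by `λ_j`. -/
def canonicalState {ι n : Type} [Fintype n] [DecidableEq n]
    (ρ : Matrix n n ℂ) (a : ι → Matrix n n ℂ) (j : ι) : Matrix n n ℂ :=
  (outcomeProb ρ a j)⁻¹ • (cfc Real.sqrt ρ * a j * cfc Real.sqrt ρ)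

/-- The entropy defect `H(ρ) - ∑_j λ_j H(ρ̂_j)`. -/
def entropyDefect {ι n : Type} [Fintype ι] [Fintype n] [DecidableEq n]
    (ρ : Matrix n n ℂ) (a : ι → Matrix n n ℂ) : ℝ :=
  entropy ρ - ∑ j, outcomeProb ρ a j * entropy (canonicalState ρ a j)

/-- The tensor product `F_1 ⊗ ⋯ ⊗ F_l`, as a matrix in the product basis, whose elements are
indexed by the words `Fin l → Fin d`. -/
def tensor {l d : ℕ} (F : Fin l → Matrix (Fin d) (Fin d) ℂ) :
    Matrix (Fin l → Fin d) (Fin l → Fin d) ℂ :=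
  Matrix.of fun x y => ∏ i, F i (x i) (y i)

/-- The partial trace `Tr_{≠ k}` over all tensor factors except the `k`-th. -/
def partialTraceExcept {l d : ℕ} (k : Fin l)
    (X : Matrix (Fin l → Fin d) (Fin l → Fin d) ℂ) : Matrix (Fin d) (Fin d) ℂ :=
  Matrix.of fun s t => ∑ z : {i : Fin l // i ≠ k} → Fin d,
    X ((Equiv.funSplitAt k (Fin d)).symm (s, z)) ((Equiv.funSplitAt k (Fin d)).symm (t, z))

/-- The marginal `A^{(k)}_j = Tr_{≠ k} ((ρ^{⊗ [l] ∖ k} ⊗ 1_k) ∑_{μ : j_{μ k} = j} A_μ)` of a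
measurement `A` whose outcome `μ` is labelled by the word `w μ = (j_{μ 1}, …, j_{μ l})`. -/
def marginal {l d m M : ℕ} (ρ : Matrix (Fin d) (Fin d) ℂ)
    (A : Fin M → Matrix (Fin l → Fin d) (Fin l → Fin d) ℂ) (w : Fin M → Fin l → Fin m)
    (k : Fin l) (j : Fin m) : Matrix (Fin d) (Fin d) ℂ :=
  partialTraceExcept k
    (tensor (Function.update (fun _ => ρ) k 1) * ∑ μ with w μ k = j, A μ)

/-- The operator norm with respect to the Euclidean norm on `ℂ^n`. -/
def opNorm {n : Type} [Fintype n] [DecidableEq n] (X : Matrix n n ℂ) : ℝ :=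
  ‖Matrix.toEuclideanCLM (n := n) (𝕜 := ℂ) X‖

end POVMCompression

end

/-! Put t = 1/(2l) and ρ' = (1-t)ρ + t/d. The product measurement a_J = a_{J 1} ⊗ ⋯ ⊗ a_{J l} has
marginals exactly a_j, but m^l outcomes. Factor a_j = N_j N_jᴴ with N_jᴴ ρ' N_j diagonal, with
entries s_j(y) (`exists_factorization`), and let p(J) be the product of the numbers (1-t)λ_j + t/m.
Keep in a_J = N_J N_Jᴴ only the basis words y with s_J(y) ≤ p(J) exp(-l ∑ λ_j H(ρ̂_j) + O(√l)),
conjugate with a projection P ≤ exp(l H(ρ) + O(√l)) ρ'^{⊗l}, and divide by p(J). The resulting X_J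
satisfy X_J² ≤ B X_J with B = exp(l · defect + O(√l)) (`cut_mul_self_le`) and ∑ p(J) X_J ≤ 1, and by
Chebyshev's inequality the marginals stay close to a_j (`exists_typicalResolution`).

Now sample M words from p. In the seminorm (Tr ω D²)^{1/2} the empirical average of the X_J has mean
square error at most Tr(ω) B / M (`exists_sample`). The weight ω = ρ ⊗ ⋯ ⊗ 1_k ⊗ ⋯ ⊗ ρ has trace d
only, and dominates every ρ ⊗ ⋯ ⊗ vvᴴ ⊗ ⋯ ⊗ ρ with v a unit vector; by Cauchy-Schwarz it controls
the whole quadratic form of the k-th marginal, without concentration in operator norm. Treating all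
positions and outcomes together costs a factor l(m+1). The average S need not be ≤ 1, but
conjugation with (1 + |S - G|)⁻¹, G being the mean, repairs this and hardly changes expectations
(`exists_truncated`). One more outcome completes the measurement (`exists_completed`).

The constant is uniform in ρ and a, although their spectra have no lower bound: second moments
involve only x log² x ≤ 4, and mixing with weight t bounds the logarithm at the one exceptional
position by O(log l), at the price of a factor (1-t)^{-l} ≤ 2 in probabilities. -/

noncomputable section

namespace POVMCompression

open Matrix
open scoped MatrixOrder

set_option linter.unusedSectionVars false

/-! ### Expectations, the Hilbert-Schmidt norm, truncation and empirical averages. -/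

section Basic

variable {n : Type} [Fintype n]

/-- The expectation value `Re Tr (ω A)`. -/
def ev (ω A : Matrix n n ℂ) : ℝ := (ω * A).trace.re

lemma ev_add (ω A B : Matrix n n ℂ) : ev ω (A + B) = ev ω A + ev ω B := by
  simp [ev, mul_add, trace_add]

lemma ev_sub (ω A B : Matrix n n ℂ) : ev ω (A - B) = ev ω A - ev ω B := by
  simp [ev, mul_sub, trace_sub]

lemma ev_smul (ω A : Matrix n n ℂ) (c : ℝ) : ev ω (c • A) = c * ev ω A := by
  simp [ev, trace_smul]

lemma ev_sum {ι : Type*} (s : Finset ι) (ω : Matrix n n ℂ) (A : ι → Matrix n n ℂ) :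
    ev ω (∑ i ∈ s, A i) = ∑ i ∈ s, ev ω (A i) := by
  simp [ev, Matrix.mul_sum, trace_sum]

lemma ev_comm (ω A : Matrix n n ℂ) : ev ω A = ev A ω := by
  rw [ev, ev, trace_mul_comm]

lemma exists_conjTranspose_mul_self {A : Matrix n n ℂ} (hA : A.PosSemidef) :
    ∃ B : Matrix n n ℂ, A = Bᴴ * B := by
  classical
  exact CStarAlgebra.nonneg_iff_eq_star_mul_self.mp hA.nonneg

lemma ev_nonneg {ω A : Matrix n n ℂ} (hω : ω.PosSemidef) (hA : A.PosSemidef) : 0 ≤ ev ω A := by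
  obtain ⟨B, rfl⟩ := exists_conjTranspose_mul_self hω
  rw [ev, mul_assoc, trace_mul_comm]
  exact (Complex.le_def.1 (hA.mul_mul_conjTranspose_same B).trace_nonneg).1

lemma ev_mono {ω A B : Matrix n n ℂ} (hω : ω.PosSemidef) (h : A ≤ B) : ev ω A ≤ ev ω B := by
  have := ev_nonneg hω (le_iff.1 h)
  rw [ev_sub] at this
  linarith

lemma ev_mono_left {ω ω' A : Matrix n n ℂ} (hA : A.PosSemidef) (h : ω ≤ ω') :
    ev ω A ≤ ev ω' A := by
  rw [ev_comm ω, ev_comm ω']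
  exact ev_mono hA h

lemma conj_mono {A B : Matrix n n ℂ} (h : A ≤ B) (C : Matrix n n ℂ) :
    C * A * Cᴴ ≤ C * B * Cᴴ := by
  rw [le_iff] at h ⊢
  simpa [mul_sub, sub_mul] using h.mul_mul_conjTranspose_same C

lemma conj_mono' {A B : Matrix n n ℂ} (h : A ≤ B) (C : Matrix n n ℂ) :
    Cᴴ * A * C ≤ Cᴴ * B * C := by
  simpa using conj_mono h Cᴴ

lemma smul_mono {A B : Matrix n n ℂ} (h : A ≤ B) {c : ℝ} (hc : 0 ≤ c) : c • A ≤ c • B := by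
  rw [le_iff] at h ⊢
  rw [← smul_sub]
  exact h.smul hc

/-- The squared Hilbert-Schmidt norm. -/
def hsSq (A : Matrix n n ℂ) : ℝ := ∑ i, ∑ j, ‖A i j‖ ^ 2

lemma trace_mul_conjTranspose_re (A : Matrix n n ℂ) : (A * Aᴴ).trace.re = hsSq A := by
  simp [trace, mul_apply, hsSq, Complex.mul_conj, Complex.normSq_eq_norm_sq,
    -Complex.ofReal_pow]

/-- Square roots of the weight and of the observable turn expectations into squared norms in a
Hilbert space, where the triangle inequality is available. -/
lemma ev_conj_eq_hsSq (Ω Y b : Matrix n n ℂ) :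
    ev (Ωᴴ * Ω) (Y * (b * bᴴ) * Yᴴ) = hsSq (Ω * Y * b) := by
  rw [← trace_mul_conjTranspose_re, ev]
  simp only [conjTranspose_mul, mul_assoc]
  rw [trace_mul_comm]
  simp only [mul_assoc]

/-- A matrix as a vector of the Hilbert-Schmidt space. -/
def hsVec (A : Matrix n n ℂ) : EuclideanSpace ℂ (n × n) := WithLp.toLp 2 fun q => A q.1 q.2

lemma norm_hsVec_sq (A : Matrix n n ℂ) : ‖hsVec A‖ ^ 2 = hsSq A := by
  simp [hsVec, hsSq, EuclideanSpace.norm_sq_eq, Fintype.sum_prod_type]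

lemma hsVec_sub (A B : Matrix n n ℂ) : hsVec (A - B) = hsVec A - hsVec B := by
  ext; simp [hsVec]

lemma norm_hsVec (A : Matrix n n ℂ) : ‖hsVec A‖ = √(hsSq A) := by
  rw [← norm_hsVec_sq, Real.sqrt_sq (norm_nonneg _)]

variable [DecidableEq n]

lemma exists_self_mul_conjTranspose {A : Matrix n n ℂ} (hA : A.PosSemidef) :
    ∃ B : Matrix n n ℂ, A = B * Bᴴ := by
  obtain ⟨B, h⟩ := exists_conjTranspose_mul_self hA
  exact ⟨Bᴴ, by simpa using h⟩

/-- Gentle measurement: if `T` is close to `1` in a weighted `L²` sense then `T B Tᴴ` and `B` have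
nearly the same expectation. -/
lemma abs_ev_conj_sub_le {ω B : Matrix n n ℂ} (hω : ω.PosSemidef) (hB : B.PosSemidef)
    (T : Matrix n n ℂ) :
    |ev ω (T * B * Tᴴ) - ev ω B| ≤
      √(ev ω ((T - 1) * B * (T - 1)ᴴ)) * (√(ev ω (T * B * Tᴴ)) + √(ev ω B)) := by
  obtain ⟨Ω, rfl⟩ := exists_conjTranspose_mul_self hω
  obtain ⟨b, rfl⟩ := exists_self_mul_conjTranspose hB
  have h1 : ev (Ωᴴ * Ω) (b * bᴴ) = hsSq (Ω * 1 * b) := by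
    simpa using ev_conj_eq_hsSq Ω 1 b
  rw [h1, ev_conj_eq_hsSq, ev_conj_eq_hsSq, ← norm_hsVec, ← norm_hsVec, ← norm_hsVec,
    ← norm_hsVec_sq, ← norm_hsVec_sq]
  set x := hsVec (Ω * T * b)
  set y := hsVec (Ω * 1 * b)
  have h2 : hsVec (Ω * (T - 1) * b) = x - y := by
    rw [← hsVec_sub]; simp [mul_sub, sub_mul]
  rw [h2, sq_sub_sq, abs_mul, mul_comm, abs_of_nonneg (a := ‖x‖ + ‖y‖) (by positivity)]
  gcongr
  exact abs_norm_sub_norm_le x y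

/-- Cauchy-Schwarz: `|Tr ω D| ≤ (Tr ω D²)^{1/2}` for a state `ω`. -/
lemma abs_ev_le_sqrt {ω D : Matrix n n ℂ} (hω : ω.PosSemidef) (h1 : ω.trace = 1)
    (hD : D.IsHermitian) : |ev ω D| ≤ √(ev ω (D * D)) := by
  apply Real.abs_le_sqrt
  set c := ev ω D with hc
  have h : 0 ≤ ev ω ((D - c • 1) * (D - c • 1)ᴴ) :=
    ev_nonneg hω (posSemidef_self_mul_conjTranspose _)
  have h2 : (D - c • 1) * (D - c • 1)ᴴ = D * D - (2 * c) • D + (c ^ 2) • 1 := by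
    rw [conjTranspose_sub, hD.eq]
    simp only [conjTranspose_smul, star_trivial, conjTranspose_one, sub_mul, mul_sub, smul_mul_assoc,
      mul_smul_comm, one_mul, mul_one]
    module
  have h3 : ev ω 1 = 1 := by simp [ev, h1]
  rw [h2, ev_add, ev_sub, ev_smul, ev_smul, ← hc, h3] at h
  nlinarith

lemma ev_one {ω : Matrix n n ℂ} : ev ω 1 = ω.trace.re := by simp [ev]

/-- Diagonalization of a Hermitian matrix. -/
lemma exists_diagonalization {A : Matrix n n ℂ} (hA : A.IsHermitian) :
    ∃ U : Matrix n n ℂ, Uᴴ * U = 1 ∧ U * Uᴴ = 1 ∧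
      A = U * diagonal (fun i => (hA.eigenvalues i : ℂ)) * Uᴴ := by
  refine ⟨hA.eigenvectorUnitary, ?_, ?_, ?_⟩
  · exact Unitary.coe_star_mul_self hA.eigenvectorUnitary
  · exact Unitary.coe_mul_star_self hA.eigenvectorUnitary
  · exact hA.spectral_theorem

lemma conj_diagonal_mul {U : Matrix n n ℂ} (hU : Uᴴ * U = 1) (f g : n → ℂ) :
    (U * diagonal f * Uᴴ) * (U * diagonal g * Uᴴ) = U * diagonal (fun i => f i * g i) * Uᴴ := by
  calc _ = U * diagonal f * (Uᴴ * U) * diagonal g * Uᴴ := by simp only [mul_assoc]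
    _ = _ := by rw [hU, mul_one, mul_assoc U, diagonal_mul_diagonal]

lemma conj_diagonal_le {U : Matrix n n ℂ} {f g : n → ℝ} (h : ∀ i, f i ≤ g i) :
    U * diagonal (fun i => (f i : ℂ)) * Uᴴ ≤ U * diagonal (fun i => (g i : ℂ)) * Uᴴ := by
  apply conj_mono
  rw [le_iff, diagonal_sub]
  refine PosSemidef.diagonal fun i => ?_
  simpa using h i

/-- A truncation `T = (1 + |Δ|)⁻¹`. -/
lemma exists_truncation {Δ : Matrix n n ℂ} (hΔ : Δ.IsHermitian) :
    ∃ T : Matrix n n ℂ, T.IsHermitian ∧ T * (1 + Δ) * T ≤ 1 ∧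
      (T - 1) * (1 + Δ) * (T - 1) ≤ Δ * Δ := by
  obtain ⟨U, hU, hU', hd⟩ := exists_diagonalization hΔ
  set x := hΔ.eigenvalues
  have h1 : (1 : Matrix n n ℂ) = U * diagonal (fun _ => ((1 : ℝ) : ℂ)) * Uᴴ := by
    simp [hU']
  have h2 : 1 + Δ = U * diagonal (fun i => ((1 + x i : ℝ) : ℂ)) * Uᴴ := by
    conv_lhs => rw [h1, hd]
    rw [← add_mul, ← mul_add, diagonal_add]
    simp
  -- On an eigenvalue x the claims read f²(1+x) ≤ 1 and (f-1)²(1+x) ≤ x²; this f satisfies both for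
  -- every real x.
  let f : n → ℝ := fun i => (1 + |x i|)⁻¹
  have hpos : ∀ i, 0 < 1 + |x i| := fun i => by positivity
  have h3 : U * diagonal (fun i => (f i : ℂ)) * Uᴴ - 1
      = U * diagonal (fun i => ((f i - 1 : ℝ) : ℂ)) * Uᴴ := by
    conv_lhs => rw [h1]
    rw [← sub_mul, ← mul_sub, diagonal_sub]
    simp
  refine ⟨U * diagonal (fun i => (f i : ℂ)) * Uᴴ, ?_, ?_, ?_⟩
  · simp [IsHermitian, mul_assoc, diagonal_conjTranspose, Pi.star_def]
  · rw [h2, conj_diagonal_mul hU, conj_diagonal_mul hU]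
    conv_rhs => rw [h1]
    simp only [← Complex.ofReal_mul]
    refine conj_diagonal_le fun i => ?_
    have hx := le_abs_self (x i)
    have h := hpos i
    simp only [f]
    calc (1 + |x i|)⁻¹ * (1 + x i) * (1 + |x i|)⁻¹
        ≤ (1 + |x i|)⁻¹ * (1 + |x i|) * (1 + |x i|)⁻¹ := by gcongr
      _ = (1 + |x i|)⁻¹ := by field_simp
      _ ≤ 1 := inv_le_one_of_one_le₀ (by linarith [abs_nonneg (x i)])
  · rw [h3, h2, conj_diagonal_mul hU, conj_diagonal_mul hU]
    conv_rhs => rw [hd, conj_diagonal_mul hU]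
    simp only [← Complex.ofReal_mul]
    refine conj_diagonal_le fun i => ?_
    have hx := le_abs_self (x i)
    have h := hpos i
    have h0 := abs_nonneg (x i)
    have e : f i - 1 = -(|x i| / (1 + |x i|)) := by simp only [f]; field_simp; ring
    rw [e]
    calc -(|x i| / (1 + |x i|)) * (1 + x i) * -(|x i| / (1 + |x i|))
        = (|x i| / (1 + |x i|)) ^ 2 * (1 + x i) := by ring
      _ ≤ (|x i| / (1 + |x i|)) ^ 2 * (1 + |x i|) := by gcongr
      _ = |x i| ^ 2 / (1 + |x i|) := by field_simp
      _ ≤ |x i| ^ 2 := div_le_self (by positivity) (by linarith)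
      _ = x i * x i := by rw [sq_abs, sq]

/-- Empirical approximation of a convex combination in a Hilbert space. -/
lemma exists_empirical {E W : Type*} [NormedAddCommGroup E] [InnerProductSpace ℂ E] [Fintype W]
    (p : W → ℝ) (hp : ∀ w, 0 ≤ p w) (hp1 : ∑ w, p w = 1) (x : W → E) (M : ℕ) :
    ∃ w : Fin M → W, ‖∑ μ, (x (w μ) - ∑ v, (p v : ℂ) • x v)‖ ^ 2 ≤ M * ∑ v, p v * ‖x v‖ ^ 2 := by
  set c := ∑ v, (p v : ℂ) • x v with hc
  -- The cross term averages to zero, so adding one sample raises the squared norm in mean by at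
  -- most the second moment. Some v is no worse than the mean, and a greedy choice replaces random
  -- sampling.
  have var : ∀ V : E, ∑ v, p v * ‖V + (x v - c)‖ ^ 2 ≤ ‖V‖ ^ 2 + ∑ v, p v * ‖x v‖ ^ 2 := by
    intro V
    have e : ∀ v, p v * ‖V + (x v - c)‖ ^ 2 = p v * ‖V - c‖ ^ 2 + 2 * (p v *
        (inner ℂ (V - c) (x v)).re) + p v * ‖x v‖ ^ 2 := by
      intro v
      rw [show V + (x v - c) = (V - c) + x v by abel, @norm_add_sq ℂ]
      simp only [RCLike.re_to_complex]
      ring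
    have e2 : ∑ v, p v * (inner ℂ (V - c) (x v)).re = (inner ℂ (V - c) c).re := by
      have h : inner ℂ (V - c) c = ∑ v, (p v : ℂ) * inner ℂ (V - c) (x v) := by
        conv_lhs => rw [inner_sum]
        exact Finset.sum_congr rfl fun v _ => inner_smul_right _ _ _
      rw [h, Complex.re_sum]
      refine Finset.sum_congr rfl fun v _ => ?_
      rw [Complex.re_ofReal_mul]
    simp only [e, Finset.sum_add_distrib, ← Finset.mul_sum, ← Finset.sum_mul, e2, hp1, one_mul]
    have e3 : ‖V‖ ^ 2 = ‖V - c‖ ^ 2 + 2 * (inner ℂ (V - c) c).re + ‖c‖ ^ 2 := by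
      have := @norm_add_sq ℂ _ _ _ _ (V - c) c
      rwa [sub_add_cancel] at this
    nlinarith [sq_nonneg ‖c‖]
  induction M with
  | zero => exact ⟨Fin.elim0, by simp⟩
  | succ M ih =>
    obtain ⟨w, hw⟩ := ih
    set V := ∑ μ, (x (w μ) - c)
    obtain ⟨v, hv⟩ : ∃ v, ‖V + (x v - c)‖ ^ 2 ≤ ‖V‖ ^ 2 + ∑ v, p v * ‖x v‖ ^ 2 := by
      by_contra! hcon
      set R := ‖V‖ ^ 2 + ∑ v, p v * ‖x v‖ ^ 2
      obtain ⟨v0, hv0⟩ : ∃ v, 0 < p v := by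
        by_contra! h
        have : ∑ w, p w ≤ 0 := Finset.sum_nonpos fun w _ => h w
        linarith
      have h1 : ∑ v, p v * R < ∑ v, p v * ‖V + (x v - c)‖ ^ 2 :=
        Finset.sum_lt_sum (fun v _ => mul_le_mul_of_nonneg_left (hcon v).le (hp v))
          ⟨v0, Finset.mem_univ _, mul_lt_mul_of_pos_left (hcon v0) hv0⟩
      rw [← Finset.sum_mul, hp1, one_mul] at h1
      linarith [var V]
    refine ⟨Fin.snoc w v, ?_⟩
    rw [Fin.sum_univ_castSucc]
    simp only [Fin.snoc_castSucc, Fin.snoc_last]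
    push_cast
    calc _ ≤ _ := hv
      _ ≤ _ := by rw [add_mul, one_mul]; gcongr

end Basic

/-! ### Tensor products and partial traces. -/

section Tensor

variable {l d : ℕ}

lemma tensor_mul (F G : Fin l → Matrix (Fin d) (Fin d) ℂ) :
    tensor F * tensor G = tensor fun i => F i * G i := by
  ext x y
  simp only [tensor, mul_apply, of_apply, ← Finset.prod_mul_distrib]
  rw [Finset.prod_univ_sum, Fintype.piFinset_univ]

lemma tensor_conjTranspose (F : Fin l → Matrix (Fin d) (Fin d) ℂ) :
    (tensor F)ᴴ = tensor fun i => (F i)ᴴ := by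
  ext x y
  simp [tensor]

lemma tensor_diagonal (f : Fin l → Fin d → ℂ) :
    tensor (fun i => diagonal (f i)) = diagonal fun x => ∏ i, f i (x i) := by
  ext x y
  simp only [tensor, of_apply, diagonal_apply]
  split_ifs with h
  · subst h; simp
  · obtain ⟨i, hi⟩ := Function.ne_iff.1 h
    exact Finset.prod_eq_zero (Finset.mem_univ i) (by simp [hi])

lemma tensor_one : tensor (fun _ : Fin l => (1 : Matrix (Fin d) (Fin d) ℂ)) = 1 := by
  have := tensor_diagonal (l := l) (d := d) fun _ _ => 1
  simpa using this

lemma trace_tensor (F : Fin l → Matrix (Fin d) (Fin d) ℂ) :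
    (tensor F).trace = ∏ i, (F i).trace := by
  simp only [tensor, trace, diag, of_apply]
  rw [Finset.prod_univ_sum, Fintype.piFinset_univ]

lemma sum_tensor {γ : Type*} [Fintype γ] (F : Fin l → γ → Matrix (Fin d) (Fin d) ℂ) :
    ∑ J : Fin l → γ, tensor (fun i => F i (J i)) = tensor fun i => ∑ c, F i c := by
  classical
  ext x y
  simp only [tensor, of_apply, Matrix.sum_apply]
  rw [Finset.prod_univ_sum, Fintype.piFinset_univ]

lemma tensor_posSemidef {F : Fin l → Matrix (Fin d) (Fin d) ℂ} (h : ∀ i, (F i).PosSemidef) :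
    (tensor F).PosSemidef := by
  choose B hB using fun i => exists_conjTranspose_mul_self (h i)
  have : tensor F = (tensor B)ᴴ * tensor B := by
    rw [tensor_conjTranspose, tensor_mul]
    congr 1
    ext1 i
    exact hB i
  rw [this]
  exact posSemidef_conjTranspose_mul_self _

lemma tensor_update_apply (F : Fin l → Matrix (Fin d) (Fin d) ℂ) (k : Fin l)
    (A : Matrix (Fin d) (Fin d) ℂ) (x y : Fin l → Fin d) :
    tensor (Function.update F k A) x y = A (x k) (y k) * ∏ i : {i // i ≠ k}, F i (x i) (y i) := by
  rw [tensor, of_apply, Fintype.prod_eq_mul_prod_subtype_ne _ k, Function.update_self]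
  congr 1
  refine Finset.prod_congr rfl fun i _ => ?_
  rw [Function.update_of_ne i.2]

lemma tensor_update_sub (F : Fin l → Matrix (Fin d) (Fin d) ℂ) (k : Fin l)
    (A B : Matrix (Fin d) (Fin d) ℂ) :
    tensor (Function.update F k (A - B))
      = tensor (Function.update F k A) - tensor (Function.update F k B) := by
  ext x y
  simp [tensor_update_apply, sub_mul]

lemma sum_tensor_of_apply_eq {γ : Type*} [Fintype γ] [DecidableEq γ]
    (F : γ → Matrix (Fin d) (Fin d) ℂ) (k : Fin l) (j : γ) :
    ∑ J : Fin l → γ with J k = j, tensor (fun i => F (J i))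
      = tensor (Function.update (fun _ => ∑ c, F c) k (F j)) := by
  have h := sum_tensor (Function.update (fun _ => F) k
    (fun c => if c = j then F c else 0) : Fin l → γ → Matrix (Fin d) (Fin d) ℂ)
  have e1 : (fun i => ∑ c, (Function.update (fun _ => F) k
      (fun c => if c = j then F c else 0) : Fin l → γ → Matrix (Fin d) (Fin d) ℂ) i c)
      = Function.update (fun _ => ∑ c, F c) k (F j) := by
    ext1 i
    by_cases hi : i = k
    · subst hi; simp
    · simp [Function.update_of_ne hi]
  rw [e1] at h
  rw [← h, Finset.sum_filter]
  refine Finset.sum_congr rfl fun J _ => ?_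
  split_ifs with hJ
  · congr 1
    ext1 i
    by_cases hi : i = k
    · subst hi; simp [hJ]
    · simp [Function.update_of_ne hi]
  · ext x y
    rw [tensor, of_apply]
    symm
    exact Finset.prod_eq_zero (Finset.mem_univ k) (by simp [hJ])

/-- Reduces every question about marginals to expectations in product operators that differ from
ρ^{⊗l} only at position k. After expansion the 1 at position k collapses one sum. -/
lemma dotProduct_partialTraceExcept (ρ : Matrix (Fin d) (Fin d) ℂ) (k : Fin l)
    (Y : Matrix (Fin l → Fin d) (Fin l → Fin d) ℂ) (v : Fin d → ℂ) :
    star v ⬝ᵥ partialTraceExcept k (tensor (Function.update (fun _ => ρ) k 1) * Y) *ᵥ v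
      = (tensor (Function.update (fun _ => ρ) k (vecMulVec v (star v))) * Y).trace := by
  have hsplit : ∀ (s : Fin d) (z : {i : Fin l // i ≠ k} → Fin d) (x : Fin l → Fin d)
      (A : Matrix (Fin d) (Fin d) ℂ),
      tensor (Function.update (fun _ => ρ) k A) ((Equiv.funSplitAt k (Fin d)).symm (s, z)) x
        = A s (x k) * ∏ i : {i // i ≠ k}, ρ (z i) (x i) := by
    intro s z x A
    rw [tensor_update_apply]
    congr 1
    · simp
    · refine Finset.prod_congr rfl fun i _ => ?_
      simp [i.2]
  have hR : (tensor (Function.update (fun _ => ρ) k (vecMulVec v (star v))) * Y).trace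
      = ∑ t, ∑ z : {i : Fin l // i ≠ k} → Fin d, ∑ x, v t * star (v (x k)) *
        (∏ i : {i // i ≠ k}, ρ (z i) (x i)) * Y x ((Equiv.funSplitAt k (Fin d)).symm (t, z)) := by
    rw [trace, ← Equiv.sum_comp (Equiv.funSplitAt k (Fin d)).symm, Fintype.sum_prod_type]
    refine Finset.sum_congr rfl fun t _ => Finset.sum_congr rfl fun z _ => ?_
    rw [diag_apply, mul_apply]
    refine Finset.sum_congr rfl fun x _ => ?_
    rw [hsplit]
    rfl
  rw [hR]
  simp only [dotProduct, mulVec, partialTraceExcept, of_apply, mul_apply, hsplit, Finset.sum_mul,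
    Finset.mul_sum]
  rw [Finset.sum_comm]
  refine Finset.sum_congr rfl fun t _ => ?_
  rw [Finset.sum_comm]
  refine Finset.sum_congr rfl fun z _ => ?_
  rw [Finset.sum_comm]
  refine Finset.sum_congr rfl fun x _ => ?_
  rw [Finset.sum_eq_single (x k)]
  · simp only [one_apply_eq, Pi.star_apply]; ring
  · intro s _ hs
    simp [one_apply_ne hs]
  · simp

end Tensor

/-! ### Operator norm and hermiticity from quadratic forms. -/

section OpNorm

variable {n : Type} [Fintype n] [DecidableEq n]

open scoped Matrix.Norms.L2Operator in
lemma opNorm_le_of_hermitian {D : Matrix n n ℂ} (hD : D.IsHermitian) {δ : ℝ} (hδ : 0 ≤ δ)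
    (h : ∀ v : n → ℂ, star v ⬝ᵥ v = 1 → |(star v ⬝ᵥ D *ᵥ v).re| ≤ δ) : opNorm D ≤ δ := by
  have h1 : opNorm D = ‖D‖ := (Matrix.l2_opNorm_def D).symm
  have hev : ∀ i, |hD.eigenvalues i| ≤ δ := by
    intro i
    rw [hD.eigenvalues_eq]
    refine h _ ?_
    have := hD.eigenvectorBasis.orthonormal.1 i
    have h2 : inner ℂ (hD.eigenvectorBasis i) (hD.eigenvectorBasis i) = (1 : ℂ) := by
      rw [inner_self_eq_norm_sq_to_K, this]; simp
    rw [EuclideanSpace.inner_eq_star_dotProduct, dotProduct_comm] at h2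
    exact h2
  rw [h1, hD.spectral_theorem, Unitary.conjStarAlgAut_apply, ← Unitary.coe_star,
    CStarRing.norm_mul_coe_unitary,
    CStarRing.norm_coe_unitary_mul, Matrix.l2_opNorm_diagonal, pi_norm_le_iff_of_nonneg hδ]
  intro i
  simpa using hev i

/-- Needed because a marginal is the partial trace of a product of two matrices, which is not
visibly Hermitian. -/
lemma isHermitian_of_dotProduct_real {D : Matrix n n ℂ}
    (h : ∀ v : n → ℂ, (star v ⬝ᵥ D *ᵥ v).im = 0) : D.IsHermitian := by
  rw [← Matrix.isSymmetric_toEuclideanLin_iff, LinearMap.isSymmetric_iff_inner_map_self_real]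
  intro v
  have h1 : inner ℂ v (toEuclideanLin D v) = star (WithLp.ofLp v) ⬝ᵥ D *ᵥ WithLp.ofLp v := by
    rw [EuclideanSpace.inner_eq_star_dotProduct, dotProduct_comm]
    rfl
  rw [inner_conj_symm, h1, ← inner_conj_symm, h1]
  exact (Complex.conj_eq_iff_im.2 (h _)).symm

end OpNorm

/-! ### Chebyshev's inequality for product distributions on words. -/

section Chebyshev

variable {ι γ : Type*} [Fintype ι] [DecidableEq ι] [Fintype γ]

lemma sum_pi_prod (p : ι → γ → ℝ) : ∑ x : ι → γ, ∏ i, p i (x i) = ∏ i, ∑ a, p i a := by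
  classical
  rw [Finset.prod_univ_sum, Fintype.piFinset_univ]

/-- The variance of a sum of independent centred random variables. -/
lemma sum_pi_prod_mul_sq (p f : ι → γ → ℝ) (h1 : ∀ i, ∑ a, p i a = 1)
    (h0 : ∀ i, ∑ a, p i a * f i a = 0) :
    ∑ x : ι → γ, (∏ i, p i (x i)) * (∑ i, f i (x i)) ^ 2 = ∑ i, ∑ a, p i a * f i a ^ 2 := by
  have key : ∀ a b, ∑ x : ι → γ, (∏ i, p i (x i)) * (f a (x a) * f b (x b))
      = if a = b then ∑ c, p a c * f a c ^ 2 else 0 := by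
    intro a b
    have e : ∀ x : ι → γ, (∏ i, p i (x i)) * (f a (x a) * f b (x b)) = ∏ i, p i (x i) *
        ((if i = a then f i (x i) else 1) * (if i = b then f i (x i) else 1)) := by
      intro x
      simp only [Finset.prod_mul_distrib, Finset.prod_ite_eq', Finset.mem_univ, if_true]
    simp only [e]
    rw [sum_pi_prod (fun i c => p i c *
      ((if i = a then f i c else 1) * (if i = b then f i c else 1)))]
    split_ifs with hab
    · subst hab
      rw [Finset.prod_eq_single a]
      · simp [sq]
      · intro i _ hi; simp [hi, h1]
      · simp
    · exact Finset.prod_eq_zero (Finset.mem_univ a) (by simp [hab, h0])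
  have hsq : ∀ x : ι → γ, (∏ i, p i (x i)) * (∑ i, f i (x i)) ^ 2
      = ∑ a, ∑ b, (∏ i, p i (x i)) * (f a (x a) * f b (x b)) := by
    intro x
    rw [sq, Finset.sum_mul_sum, Finset.mul_sum]
    simp only [Finset.mul_sum]
  simp only [hsq]
  rw [Finset.sum_comm]
  refine Finset.sum_congr rfl fun a _ => ?_
  rw [Finset.sum_comm]
  simp [key]

lemma sum_pi_prod_le (p f : ι → γ → ℝ) (hp : ∀ i a, 0 ≤ p i a) (h1 : ∀ i, ∑ a, p i a = 1)
    (h0 : ∀ i, ∑ a, p i a * f i a = 0) {V θ : ℝ} (hθ : 0 < θ)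
    (hV : ∀ i, ∑ a, p i a * f i a ^ 2 ≤ V) (S : Finset (ι → γ))
    (hS : ∀ x ∈ S, (∏ i, p i (x i)) ≠ 0 → θ ≤ |∑ i, f i (x i)|) :
    ∑ x ∈ S, ∏ i, p i (x i) ≤ Fintype.card ι * V / θ ^ 2 := by
  have hP : ∀ x : ι → γ, 0 ≤ ∏ i, p i (x i) := fun x => Finset.prod_nonneg fun i _ => hp _ _
  have h2 : ∑ x ∈ S, (∏ i, p i (x i)) * θ ^ 2
      ≤ ∑ x ∈ S, (∏ i, p i (x i)) * (∑ i, f i (x i)) ^ 2 := by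
    refine Finset.sum_le_sum fun x hx => ?_
    by_cases h : ∏ i, p i (x i) = 0
    · rw [h, zero_mul, zero_mul]
    · refine mul_le_mul_of_nonneg_left ?_ (hP x)
      rw [← sq_abs (∑ i, f i (x i))]
      exact pow_le_pow_left₀ hθ.le (hS x hx h) 2
  have h3 : ∑ x ∈ S, (∏ i, p i (x i)) * (∑ i, f i (x i)) ^ 2
      ≤ ∑ x : ι → γ, (∏ i, p i (x i)) * (∑ i, f i (x i)) ^ 2 :=
    Finset.sum_le_sum_of_subset_of_nonneg (Finset.subset_univ _)
      fun x _ _ => mul_nonneg (hP x) (sq_nonneg _)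
  rw [sum_pi_prod_mul_sq p f h1 h0] at h3
  have h4 : ∑ i, ∑ a, p i a * f i a ^ 2 ≤ Fintype.card ι * V := by
    refine (Finset.sum_le_sum fun i _ => hV i).trans_eq ?_
    rw [Finset.sum_const, Finset.card_univ, nsmul_eq_mul]
  rw [le_div_iff₀ (pow_pos hθ 2), Finset.sum_mul]
  exact h2.trans (h3.trans h4)

lemma sum_mul_sub_mean_sq_le (q Z : γ → ℝ) (hq1 : ∑ a, q a = 1) :
    ∑ a, q a * (Z a - ∑ b, q b * Z b) ^ 2 ≤ ∑ a, q a * Z a ^ 2 := by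
  generalize hμ : ∑ b, q b * Z b = μ
  have e : ∀ a, q a * (Z a - μ) ^ 2 = q a * Z a ^ 2 - 2 * μ * (q a * Z a) + μ ^ 2 * q a :=
    fun a => by ring
  simp only [e, Finset.sum_add_distrib, Finset.sum_sub_distrib, ← Finset.mul_sum, hq1, hμ]
  nlinarith [sq_nonneg μ]

/-- Chebyshev's inequality for words whose letters are independent, with distribution `q` except at
the position `k`. -/
lemma sum_update_prod_le (q g : γ → ℝ) (hq : ∀ a, 0 ≤ q a) (hg : ∀ a, 0 ≤ g a)
    (hq1 : ∑ a, q a = 1) (hg1 : ∑ a, g a = 1) (k : ι) (Z : γ → ℝ) {V θ : ℝ} (hθ : 0 < θ)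
    (hV : ∑ a, q a * Z a ^ 2 ≤ V) (S : Finset (ι → γ))
    (hS : ∀ x ∈ S, (∏ i, (if i = k then g else q) (x i)) ≠ 0 →
      θ ≤ |∑ i ∈ Finset.univ.erase k, (Z (x i) - ∑ a, q a * Z a)|) :
    ∑ x ∈ S, ∏ i, (if i = k then g else q) (x i) ≤ Fintype.card ι * V / θ ^ 2 := by
  have hmean := sum_mul_sub_mean_sq_le q Z hq1
  generalize hμ : ∑ a, q a * Z a = μ at hS hmean
  have hV0 : 0 ≤ V := le_trans (Finset.sum_nonneg fun a _ => mul_nonneg (hq a) (sq_nonneg _)) hV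
  -- Position k, with its arbitrary distribution g, gets the zero variable: centred and without
  -- variance, so nothing about Z under g is needed.
  refine sum_pi_prod_le (fun i => if i = k then g else q)
    (fun i a => if i = k then 0 else Z a - μ) ?_ ?_ ?_ hθ ?_ S ?_
  · intro i a
    split_ifs
    exacts [hg a, hq a]
  · intro i
    split_ifs
    exacts [hg1, hq1]
  · intro i
    by_cases hi : i = k
    · simp [hi]
    · simp [hi, mul_sub, ← Finset.sum_mul, hq1, hμ]
  · intro i
    by_cases hi : i = k
    · simpa [hi] using hV0
    · simpa [hi] using hmean.trans hV
  · intro x hx h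
    convert hS x hx h using 2
    rw [← Finset.add_sum_erase _ _ (Finset.mem_univ k)]
    simp only [if_true, zero_add]
    exact Finset.sum_congr rfl fun i hi => by simp [Finset.ne_of_mem_erase hi]

end Chebyshev

/-! ### Von Neumann entropy: spectral invariance and concavity. -/

section Entropy

variable {n : Type} [Fintype n] [DecidableEq n]

lemma entropy_eq_sum {A : Matrix n n ℂ} (hA : A.IsHermitian) :
    entropy A = ∑ i, Real.negMulLog (hA.eigenvalues i) := by
  rw [entropy, hA.cfc_eq, IsHermitian.cfc, Unitary.conjStarAlgAut_apply, trace_mul_cycle,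
    Unitary.coe_star_mul_self, one_mul, trace_diagonal]
  simp

/-- Through the characteristic polynomial the entropy visibly depends on the spectrum alone, so
`charpoly_mul_comm` applies to it. -/
lemma entropy_eq_sum_roots {A : Matrix n n ℂ} (hA : A.IsHermitian) :
    entropy A = (A.charpoly.roots.map fun z => Real.negMulLog z.re).sum := by
  rw [entropy_eq_sum hA, hA.roots_charpoly_eq_eigenvalues, Multiset.map_map]
  simp

lemma entropy_mul_conjTranspose_comm (A : Matrix n n ℂ) :
    entropy (A * Aᴴ) = entropy (Aᴴ * A) := by
  rw [entropy_eq_sum_roots (isHermitian_mul_conjTranspose_self A),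
    entropy_eq_sum_roots (isHermitian_conjTranspose_mul_self A), charpoly_mul_comm]

lemma isHermitian_conj_diagonal (U : Matrix n n ℂ) (f : n → ℝ) :
    (U * diagonal (fun i => (f i : ℂ)) * Uᴴ).IsHermitian := by
  simp [IsHermitian, mul_assoc, diagonal_conjTranspose, Pi.star_def]

lemma entropy_conj_diagonal {U : Matrix n n ℂ} (hU : Uᴴ * U = 1) (f : n → ℝ) :
    entropy (U * diagonal (fun i => (f i : ℂ)) * Uᴴ) = ∑ i, Real.negMulLog (f i) := by
  rw [entropy_eq_sum_roots (isHermitian_conj_diagonal U f), charpoly_mul_comm, ← mul_assoc, hU,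
    one_mul, charpoly_diagonal, Polynomial.roots_prod]
  · simp
  · simp [Finset.prod_ne_zero_iff, Polynomial.X_sub_C_ne_zero]

lemma entropy_zero : entropy (0 : Matrix n n ℂ) = 0 := by
  simp [entropy]

lemma trace_re_conj_diagonal {U : Matrix n n ℂ} (hU : Uᴴ * U = 1) (f : n → ℝ) :
    (U * diagonal (fun i => (f i : ℂ)) * Uᴴ).trace.re = ∑ i, f i := by
  rw [trace_mul_cycle, hU, one_mul, trace_diagonal]
  simp

lemma entropy_smul {A : Matrix n n ℂ} (hA : A.IsHermitian) (c : ℝ) :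
    entropy (c • A) = c * entropy A + A.trace.re * Real.negMulLog c := by
  obtain ⟨U, hU, -, hd⟩ := exists_diagonalization hA
  generalize hA.eigenvalues = x at hd
  subst hd
  have : c • (U * diagonal (fun i => (x i : ℂ)) * Uᴴ)
      = U * diagonal (fun i => ((c * x i : ℝ) : ℂ)) * Uᴴ := by
    rw [← smul_mul_assoc, ← mul_smul_comm, ← diagonal_smul]
    congr 3
    ext i
    simp
  rw [this, entropy_conj_diagonal hU, entropy_conj_diagonal hU, trace_re_conj_diagonal hU]
  simp only [Real.negMulLog_mul, Finset.sum_add_distrib, Finset.mul_sum, Finset.sum_mul]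
  rw [add_comm]

lemma eigenvalues_le_trace {A : Matrix n n ℂ} (hA : A.PosSemidef) (i : n) :
    hA.1.eigenvalues i ≤ A.trace.re := by
  rw [hA.1.trace_eq_sum_eigenvalues]
  simp only [Complex.re_sum]
  exact Finset.single_le_sum (f := fun i => hA.1.eigenvalues i)
    (fun i _ => hA.eigenvalues_nonneg i) (Finset.mem_univ i)

lemma entropy_nonneg {A : Matrix n n ℂ} (hA : A.PosSemidef) (h1 : A.trace.re ≤ 1) :
    0 ≤ entropy A := by
  rw [entropy_eq_sum hA.1]
  exact Finset.sum_nonneg fun i _ => Real.negMulLog_nonneg (hA.eigenvalues_nonneg i)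
    ((eigenvalues_le_trace hA i).trans h1)

lemma entropy_le_card {A : Matrix n n ℂ} (hA : A.PosSemidef) :
    entropy A ≤ Fintype.card n := by
  rw [entropy_eq_sum hA.1]
  calc _ ≤ ∑ _i : n, (1 : ℝ) := Finset.sum_le_sum fun i _ => by
        have := hA.eigenvalues_nonneg i
        linarith [Real.negMulLog_le_one_sub_self this]
    _ = _ := by simp

/-- Peierls' inequality: pinching to an orthonormal basis does not decrease the entropy. -/
lemma entropy_le_sum_diag {A : Matrix n n ℂ} (hA : A.PosSemidef) {U : Matrix n n ℂ}
    (hU : Uᴴ * U = 1) (hU' : U * Uᴴ = 1) :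
    entropy A ≤ ∑ i, Real.negMulLog ((Uᴴ * A * U) i i).re := by
  obtain ⟨V, hV, hV', hd⟩ := exists_diagonalization hA.1
  rw [entropy_eq_sum hA.1]
  have hnn := hA.eigenvalues_nonneg
  generalize hA.1.eigenvalues = x at hd hnn
  -- The matrix |W i k|² is doubly stochastic: diagonal entries in the basis U are averages of
  -- eigenvalues (rows, for Jensen), and each eigenvalue is used with total weight one (columns).
  set W := Uᴴ * V with hWdef
  have hW : Wᴴ * W = 1 := by
    rw [hWdef, conjTranspose_mul, conjTranspose_conjTranspose, mul_assoc, ← mul_assoc U, hU',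
      one_mul, hV]
  have hW' : W * Wᴴ = 1 := by
    rw [hWdef, conjTranspose_mul, conjTranspose_conjTranspose, mul_assoc, ← mul_assoc V, hV',
      one_mul, hU]
  have hrow : ∀ i, ∑ k, ‖W i k‖ ^ 2 = 1 := by
    intro i
    have := congrArg Complex.re (congrFun (congrFun hW' i) i)
    simpa [mul_apply, Complex.mul_conj, Complex.normSq_eq_norm_sq, -Complex.ofReal_pow] using this
  have hcol : ∀ k, ∑ i, ‖W i k‖ ^ 2 = 1 := by
    intro k
    have := congrArg Complex.re (congrFun (congrFun hW k) k)
    simpa [mul_apply, mul_comm, Complex.mul_conj, Complex.normSq_eq_norm_sq,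
      -Complex.ofReal_pow] using this
  have hdiag : ∀ i, ((Uᴴ * A * U) i i).re = ∑ k, ‖W i k‖ ^ 2 * x k := by
    intro i
    have e : Uᴴ * A * U = W * diagonal (fun i => (x i : ℂ)) * Wᴴ := by
      conv_lhs => rw [hd]
      simp only [hWdef, conjTranspose_mul, conjTranspose_conjTranspose, mul_assoc]
    rw [e, mul_apply, Complex.re_sum]
    refine Finset.sum_congr rfl fun k _ => ?_
    rw [mul_diagonal, conjTranspose_apply, mul_right_comm, RCLike.star_def, Complex.mul_conj,
      Complex.normSq_eq_norm_sq, ← Complex.ofReal_mul, Complex.ofReal_re]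
  calc ∑ k, Real.negMulLog (x k) = ∑ k, (∑ i, ‖W i k‖ ^ 2) * Real.negMulLog (x k) := by
        simp [hcol]
    _ = ∑ i, ∑ k, ‖W i k‖ ^ 2 * Real.negMulLog (x k) := by
        simp only [Finset.sum_mul]
        rw [Finset.sum_comm]
    _ ≤ _ := by
        refine Finset.sum_le_sum fun i _ => ?_
        rw [hdiag]
        have := Real.concaveOn_negMulLog.le_map_sum (t := Finset.univ) (w := fun k => ‖W i k‖ ^ 2)
          (p := x) (fun k _ => by positivity) (hrow i) (fun k _ => hnn k)
        simpa only [smul_eq_mul] using this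

/-- Concavity of the entropy, for positive semidefinite matrices of arbitrary trace. -/
lemma sum_mul_entropy_le {ι : Type*} [Fintype ι] (w : ι → ℝ) (hw : ∀ j, 0 ≤ w j)
    (hw1 : ∑ j, w j = 1) (A : ι → Matrix n n ℂ) (hA : ∀ j, (A j).PosSemidef) :
    ∑ j, w j * entropy (A j) ≤ entropy (∑ j, w j • A j) := by
  have hS : (∑ j, w j • A j).PosSemidef :=
    posSemidef_sum _ fun j _ => (hA j).smul (hw j)
  obtain ⟨U, hU, hU', hd⟩ := exists_diagonalization hS.1
  have hx : ∀ i, hS.1.eigenvalues i = ∑ j, w j * ((Uᴴ * A j * U) i i).re := by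
    intro i
    have e : Uᴴ * (∑ j, w j • A j) * U = diagonal (fun i => (hS.1.eigenvalues i : ℂ)) := by
      conv_lhs => rw [hd]
      calc _ = (Uᴴ * U) * diagonal (fun i => (hS.1.eigenvalues i : ℂ)) * (Uᴴ * U) := by
            simp only [mul_assoc]
        _ = _ := by rw [hU, one_mul, mul_one]
    have e2 := congrArg Complex.re (congrFun (congrFun e i) i)
    rw [diagonal_apply_eq, Complex.ofReal_re] at e2
    rw [← e2]
    simp [Matrix.mul_sum, Matrix.sum_mul, Matrix.sum_apply]
  rw [entropy_eq_sum hS.1]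
  simp only [hx]
  calc ∑ j, w j * entropy (A j) ≤ ∑ j, w j * ∑ i, Real.negMulLog ((Uᴴ * A j * U) i i).re :=
        Finset.sum_le_sum fun j _ =>
          mul_le_mul_of_nonneg_left (entropy_le_sum_diag (hA j) hU hU') (hw j)
    _ = ∑ i, ∑ j, w j * Real.negMulLog ((Uᴴ * A j * U) i i).re := by
        simp only [Finset.mul_sum]
        rw [Finset.sum_comm]
    _ ≤ _ := by
        refine Finset.sum_le_sum fun i _ => ?_
        have := Real.concaveOn_negMulLog.le_map_sum (t := Finset.univ) (w := w)
          (p := fun j => ((Uᴴ * A j * U) i i).re) (fun k _ => hw k) hw1 (fun j _ =>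
            (Complex.le_def.1 ((hA j).conjTranspose_mul_mul_same U).diag_nonneg).1)
        simpa only [smul_eq_mul] using this

end Entropy

/-! ### The canonical ensemble √ρ a_j √ρ. -/

section CanonicalEnsemble

variable {n ι : Type} [Fintype n] [DecidableEq n] [Fintype ι]
  {ρ : Matrix n n ℂ} {a : ι → Matrix n n ℂ}

lemma isHermitian_cfc_sqrt (ρ : Matrix n n ℂ) : (cfc Real.sqrt ρ).IsHermitian :=
  cfc_predicate (R := ℝ) Real.sqrt ρ

lemma cfc_sqrt_mul_self (hρ : ρ.PosSemidef) : cfc Real.sqrt ρ * cfc Real.sqrt ρ = ρ := by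
  rw [hρ.1.cfc_eq, IsHermitian.cfc, ← map_mul, diagonal_mul_diagonal]
  conv_rhs => rw [hρ.1.spectral_theorem]
  congr 2
  ext i
  simp [← Complex.ofReal_mul, Real.mul_self_sqrt (hρ.eigenvalues_nonneg i)]

lemma outcomeProb_eq_ev (ρ : Matrix n n ℂ) (a : ι → Matrix n n ℂ) (j : ι) :
    outcomeProb ρ a j = ev ρ (a j) := rfl

lemma outcomeProb_nonneg (hρ : ρ.PosSemidef) (ha : IsPOVM a) (j : ι) : 0 ≤ outcomeProb ρ a j :=
  ev_nonneg hρ (ha.posSemidef j)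

lemma sum_outcomeProb (hρ : ρ.trace = 1) (ha : IsPOVM a) : ∑ j, outcomeProb ρ a j = 1 := by
  simp only [outcomeProb_eq_ev]
  rw [← ev_sum, ha.sum_eq_one, ev_one, hρ, Complex.one_re]

lemma posSemidef_sqrt_conj (ha : IsPOVM a) (j : ι) :
    (cfc Real.sqrt ρ * a j * cfc Real.sqrt ρ).PosSemidef := by
  have h := (ha.posSemidef j).mul_mul_conjTranspose_same (cfc Real.sqrt ρ)
  rwa [(isHermitian_cfc_sqrt ρ).eq] at h

lemma trace_sqrt_conj (hρ : ρ.PosSemidef) (j : ι) :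
    (cfc Real.sqrt ρ * a j * cfc Real.sqrt ρ).trace = (ρ * a j).trace := by
  rw [trace_mul_cycle, cfc_sqrt_mul_self hρ]

lemma smul_canonicalState (hρ : ρ.PosSemidef) (ha : IsPOVM a) (j : ι) :
    outcomeProb ρ a j • canonicalState ρ a j = cfc Real.sqrt ρ * a j * cfc Real.sqrt ρ := by
  by_cases h : outcomeProb ρ a j = 0
  · have hp := posSemidef_sqrt_conj (ρ := ρ) ha j
    have h0 : (cfc Real.sqrt ρ * a j * cfc Real.sqrt ρ).trace = 0 := by
      have h1 := hp.trace_nonneg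
      rw [Complex.le_def] at h1
      apply Complex.ext
      · rw [trace_sqrt_conj hρ]; exact h
      · exact h1.2.symm
    rw [h, zero_smul, hp.trace_eq_zero_iff.1 h0]
  · rw [canonicalState, smul_smul, mul_inv_cancel₀ h, one_smul]

lemma canonicalState_posSemidef (hρ : ρ.PosSemidef) (ha : IsPOVM a) (j : ι) :
    (canonicalState ρ a j).PosSemidef :=
  (posSemidef_sqrt_conj ha j).smul (inv_nonneg.2 (outcomeProb_nonneg hρ ha j))

/-- Concavity of the entropy, since the canonical ensemble averages to √ρ (∑ a_j) √ρ = ρ. -/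
lemma entropyDefect_nonneg (hρ : ρ.PosSemidef) (hρ1 : ρ.trace = 1) (ha : IsPOVM a) :
    0 ≤ entropyDefect ρ a := by
  have h := sum_mul_entropy_le _ (outcomeProb_nonneg hρ ha) (sum_outcomeProb hρ1 ha) _
    (canonicalState_posSemidef hρ ha)
  simp only [smul_canonicalState hρ ha] at h
  rw [← Matrix.sum_mul, ← Matrix.mul_sum, ha.sum_eq_one, mul_one, cfc_sqrt_mul_self hρ] at h
  rw [entropyDefect]
  linarith

/-- The entropies of the canonical ensemble in terms of a factorization `a_j = b_j b_jᴴ`. -/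
lemma outcomeProb_mul_entropy (hρ : ρ.PosSemidef) (ha : IsPOVM a) {b : ι → Matrix n n ℂ}
    (hb : ∀ j, a j = b j * (b j)ᴴ) (j : ι) :
    outcomeProb ρ a j * entropy (canonicalState ρ a j)
      = entropy ((b j)ᴴ * ρ * b j) - Real.negMulLog (outcomeProb ρ a j) := by
  -- For A = √ρ b_j the two matrices are Aᴴ A and A Aᴴ, hence isospectral.
  have h1 : entropy ((b j)ᴴ * ρ * b j) = entropy (cfc Real.sqrt ρ * a j * cfc Real.sqrt ρ) := by
    have hs := (isHermitian_cfc_sqrt ρ).eq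
    have h := entropy_mul_conjTranspose_comm (cfc Real.sqrt ρ * b j)
    have e1 : cfc Real.sqrt ρ * a j * cfc Real.sqrt ρ
        = (cfc Real.sqrt ρ * b j) * (cfc Real.sqrt ρ * b j)ᴴ := by
      rw [conjTranspose_mul, hs, hb j]
      simp only [mul_assoc]
    have e2 : (b j)ᴴ * ρ * b j = (cfc Real.sqrt ρ * b j)ᴴ * (cfc Real.sqrt ρ * b j) := by
      conv_lhs => rw [← cfc_sqrt_mul_self hρ]
      rw [conjTranspose_mul, hs]
      simp only [mul_assoc]
    rw [e1, e2, h]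
  rw [h1]
  by_cases h : outcomeProb ρ a j = 0
  · rw [← smul_canonicalState hρ ha j, h]
    simp [entropy_zero]
  · rw [← smul_canonicalState hρ ha j, entropy_smul (canonicalState_posSemidef hρ ha j).1]
    have : (canonicalState ρ a j).trace.re = 1 := by
      rw [canonicalState, trace_smul, trace_sqrt_conj hρ, Complex.real_smul, Complex.re_ofReal_mul]
      exact inv_mul_cancel₀ h
    rw [this]
    ring

end CanonicalEnsemble

/-! ### Scalar inequalities and the mixing parameter. -/

section Scalar

/-- With y = √x the left side is 4 (y log y)², and 0 ≤ -y log y ≤ 1. This makes second moments of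
log-probabilities bounded uniformly in the distribution. -/
lemma mul_log_sq_le {x : ℝ} (h0 : 0 ≤ x) (h1 : x ≤ 1) : x * Real.log x ^ 2 ≤ 4 := by
  have hs0 := Real.sqrt_nonneg x
  have hs1 : √x ≤ 1 := Real.sqrt_le_one.2 h1
  have ha := Real.negMulLog_nonneg hs0 hs1
  have hb := Real.negMulLog_le_one_sub_self hs0
  have e : x * Real.log x ^ 2 = 4 * Real.negMulLog √x ^ 2 := by
    rw [Real.negMulLog, Real.log_sqrt h0]
    conv_lhs => rw [← Real.sq_sqrt h0, Real.sq_sqrt h0]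
    have : √x ^ 2 = x := Real.sq_sqrt h0
    linear_combination (-Real.log x ^ 2) * this
  rw [e]
  nlinarith

lemma log_le_two_mul_sqrt {x : ℝ} (hx : 0 < x) : Real.log x ≤ 2 * √x := by
  have h := Real.log_le_sub_one_of_pos (Real.sqrt_pos.2 hx)
  rw [Real.log_sqrt hx.le] at h
  linarith

lemma log_one_sub_ge {t : ℝ} (h0 : 0 ≤ t) (h1 : t ≤ 1 / 2) : -(2 * t) ≤ Real.log (1 - t) := by
  have hp : 0 < 1 - t := by linarith
  have h := Real.one_sub_inv_le_log_of_pos hp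
  have : (1 - t)⁻¹ ≤ 1 + 2 * t := by
    rw [inv_le_iff_one_le_mul₀ hp]
    nlinarith
  linarith

/-- The mixing parameter `1 / (2 l)`. -/
def mixing (l : ℕ) : ℝ := 1 / (2 * l)

variable {l : ℕ} (hl : 1 ≤ l)

include hl

lemma mixing_pos : 0 < mixing l := by
  have : (0 : ℝ) < l := by exact_mod_cast hl
  unfold mixing; positivity

lemma mixing_le : mixing l ≤ 1 / 2 := by
  have : (1 : ℝ) ≤ l := by exact_mod_cast hl
  unfold mixing
  rw [div_le_div_iff₀ (by positivity) (by norm_num)]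
  linarith

lemma natCast_mul_mixing : l * mixing l = 1 / 2 := by
  have : (0 : ℝ) < l := by exact_mod_cast hl
  unfold mixing; field_simp

lemma one_le_sqrt_natCast : 1 ≤ √(l : ℝ) := by
  rw [Real.one_le_sqrt]; exact_mod_cast hl

/-- Bernoulli's inequality with l t = 1/2. It is the total cost of passing to mixed distributions at
all l positions. -/
lemma inv_one_sub_mixing_pow_le : (1 - mixing l)⁻¹ ^ l ≤ 2 := by
  have h := one_add_mul_le_pow (a := -mixing l) (by linarith [mixing_le hl]) l
  have h2 := natCast_mul_mixing hl
  have h3 : 1 / 2 ≤ (1 - mixing l) ^ l := by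
    have : 1 + -mixing l = 1 - mixing l := by ring
    rw [this] at h; linarith
  rw [inv_pow]
  calc ((1 - mixing l) ^ l)⁻¹ ≤ (1 / 2 : ℝ)⁻¹ := inv_anti₀ (by norm_num) h3
    _ = 2 := by norm_num

/-- A probability of at least t/m has a logarithm of order log l, hence O(√l); this pays for the
exceptional position. -/
lemma log_div_mixing_le {m : ℕ} (hm : 1 ≤ m) :
    Real.log (m / mixing l) ≤ 2 * √(2 * m) * √(l : ℝ) := by
  have h1 : (0 : ℝ) < l := by exact_mod_cast hl
  have h2 : (0 : ℝ) < m := by exact_mod_cast hm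
  have e : (m : ℝ) / mixing l = 2 * m * l := by unfold mixing; field_simp
  rw [e, mul_assoc (2 : ℝ) (√(2 * m)), ← Real.sqrt_mul (by positivity)]
  exact log_le_two_mul_sqrt (by positivity)

end Scalar

/-! ### Tail bounds for typical and conditionally typical words. -/

section Tails

variable {l : ℕ} (hl : 1 ≤ l)

include hl

/-- Words whose letters have distribution `r` except at one position are typical for the
mixture `(1 - t) r + t / d`, uniformly in `r`. -/
lemma sum_atypical_le {d : ℕ} (hd : 1 ≤ d) (r g : Fin d → ℝ) (hr : ∀ x, 0 < r x)
    (hr1 : ∑ x, r x = 1) (hg : ∀ x, 0 ≤ g x) (hg1 : ∑ x, g x = 1) (k : Fin l) {θ : ℝ}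
    (hθ : 0 < θ) (S : Finset (Fin l → Fin d))
    (hS : ∀ x ∈ S, ∏ i, ((1 - mixing l) * r (x i) + mixing l / d) <
      Real.exp (-(l * ∑ x, Real.negMulLog (r x) + (θ + 2 * √(2 * d) + 1) * √(l : ℝ)))) :
    ∑ x ∈ S, ∏ i, (if i = k then g else r) (x i) ≤ (8 * d + 2) / θ ^ 2 := by
  have hl0 : (0 : ℝ) < l := by exact_mod_cast hl
  have hd0 : (0 : ℝ) < d := by exact_mod_cast hd
  have hd1 : (1 : ℝ) ≤ d := by exact_mod_cast hd
  have ht := mixing_pos hl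
  have ht2 := mixing_le hl
  have hlt := natCast_mul_mixing hl
  have hsq := one_le_sqrt_natCast hl
  have hlog := log_div_mixing_le hl hd
  have hlog1 := log_one_sub_ge ht.le ht2
  set t := mixing l
  have hrle : ∀ x, r x ≤ 1 := fun x => by
    rw [← hr1]; exact Finset.single_le_sum (fun y _ => (hr y).le) (Finset.mem_univ x)
  let r' : Fin d → ℝ := fun x => (1 - t) * r x + t / d
  have htd : 0 < t / d := by positivity
  have htd1 : t / d ≤ t := div_le_self ht.le hd1
  have hr'ge : ∀ x, (1 - t) * r x ≤ r' x := fun x => by simp only [r']; linarith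
  have hr'ge2 : ∀ x, t / d ≤ r' x := fun x => by
    simp only [r']; nlinarith [hr x]
  have hr'pos : ∀ x, 0 < r' x := fun x => htd.trans_le (hr'ge2 x)
  have hr'le : ∀ x, r' x ≤ 1 := fun x => by simp only [r']; nlinarith [hrle x]
  -- Two bounds on Z are used: Z ≤ -log r + 2t gives its mean and second moment under r, and Z ≤ log
  -- (d/t) controls position k.
  let Z : Fin d → ℝ := fun x => -Real.log (r' x)
  have hZ0 : ∀ x, 0 ≤ Z x := fun x => by
    simpa [Z] using Real.log_nonpos (hr'pos x).le (hr'le x)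
  have hZ1 : ∀ x, Z x ≤ -Real.log (r x) + 2 * t := fun x => by
    have h := Real.log_le_log (by have := hr x; nlinarith) (hr'ge x)
    rw [Real.log_mul (by linarith) (hr x).ne'] at h
    simp only [Z]; linarith
  have hZ2 : ∀ x, Z x ≤ Real.log (d / t) := fun x => by
    have h := Real.log_le_log htd (hr'ge2 x)
    have h3 : Real.log (t / d) = -Real.log (d / t) := by rw [← Real.log_inv, inv_div]
    simp only [Z]; linarith
  set H := ∑ x, Real.negMulLog (r x)
  have hH0 : 0 ≤ H := Finset.sum_nonneg fun x _ => Real.negMulLog_nonneg (hr x).le (hrle x)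
  have hμ : ∑ x, r x * Z x ≤ H + 2 * t := by
    calc ∑ x, r x * Z x ≤ ∑ x, (Real.negMulLog (r x) + 2 * t * r x) :=
          Finset.sum_le_sum fun x _ => by
            have := mul_le_mul_of_nonneg_left (hZ1 x) (hr x).le
            rw [Real.negMulLog]; linarith
      _ = H + 2 * t := by rw [Finset.sum_add_distrib, ← Finset.mul_sum, hr1, mul_one]
  have hV : ∑ x, r x * Z x ^ 2 ≤ 8 * d + 2 := by
    calc ∑ x, r x * Z x ^ 2 ≤ ∑ x, (8 + 2 * r x) := Finset.sum_le_sum fun x _ => by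
          have h1 : Z x ^ 2 ≤ (-Real.log (r x) + 1) ^ 2 :=
            pow_le_pow_left₀ (hZ0 x) ((hZ1 x).trans (by linarith)) 2
          have h2 : Z x ^ 2 ≤ 2 * Real.log (r x) ^ 2 + 2 := by
            nlinarith [sq_nonneg (Real.log (r x) + 1)]
          have h3 := mul_le_mul_of_nonneg_left h2 (hr x).le
          have h4 := mul_log_sq_le (hr x).le (hrle x)
          linarith
      _ = 8 * d + 2 := by
          rw [Finset.sum_add_distrib, ← Finset.mul_sum, hr1]; simp; ring
  have key := sum_update_prod_le r g (fun x => (hr x).le) hg hr1 hg1 k Z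
    (θ := θ * √(l : ℝ)) (by positivity) hV S ?_
  · refine key.trans_eq ?_
    rw [mul_pow, Real.sq_sqrt hl0.le, Fintype.card_fin]
    field_simp
  · intro x hx _
    refine le_trans ?_ (le_abs_self _)
    have h1 := hS x hx
    have hprod : 0 < ∏ i, r' (x i) := Finset.prod_pos fun i _ => hr'pos _
    rw [← Real.log_lt_iff_lt_exp hprod, Real.log_prod fun i _ => (hr'pos (x i)).ne'] at h1
    have h2 : ∑ i, Z (x i) = -∑ i, Real.log (r' (x i)) := by simp [Z]
    rw [← Finset.add_sum_erase _ _ (Finset.mem_univ k)] at h2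
    rw [Finset.sum_sub_distrib, Finset.sum_const, Finset.card_erase_of_mem (Finset.mem_univ k),
      Finset.card_univ, Fintype.card_fin, nsmul_eq_mul, Nat.cast_sub hl, Nat.cast_one]
    have h3 := hZ2 (x k)
    have hl1 : (0 : ℝ) ≤ (l : ℝ) - 1 := by
      have : (1 : ℝ) ≤ l := by exact_mod_cast hl
      linarith
    have h4 := mul_le_mul_of_nonneg_left hμ hl1
    nlinarith

/-- Words over the alphabet of outcomes and eigenvalues are conditionally typical. -/
lemma sum_conditionally_atypical_le {γ : Type*} [Fintype γ] {m : ℕ} (hm : 1 ≤ m)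
    (s u g p : γ → ℝ) (hs : ∀ c, 0 ≤ s c)
    (hs1 : ∑ c, s c = 1) (hg : ∀ c, 0 ≤ g c) (hg1 : ∑ c, g c = 1) (hu : ∀ c, 0 ≤ u c)
    (hus : ∀ c, (1 - mixing l) * u c ≤ s c) (hp : ∀ c, mixing l / m ≤ p c)
    {h D V E : ℝ} (hhD : h ≤ D) (hD : 0 ≤ D)
    (hE : l * h - E * √(l : ℝ) ≤ l * ∑ c, s c * (Real.log (p c) - Real.log (s c)))
    (hE0 : 0 ≤ E)
    (hV : ∑ c, s c * (Real.log (p c) - Real.log (s c)) ^ 2 ≤ V)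
    (k : Fin l) {θ : ℝ} (hθ : 0 < θ) (S : Finset (Fin l → γ))
    (hS : ∀ c ∈ S, (∏ i, p (c i)) *
      Real.exp (-(l * h) + (θ + D + E + 2 * √(2 * m)) * √(l : ℝ)) < ∏ i, s (c i)) :
    ∑ c ∈ S, ∏ i, (if i = k then g else u) (c i) ≤ 2 * (V / θ ^ 2) := by
  have hl0 : (0 : ℝ) < l := by exact_mod_cast hl
  have hl1 : (1 : ℝ) ≤ l := by exact_mod_cast hl
  have hm0 : (0 : ℝ) < m := by exact_mod_cast hm
  have ht := mixing_pos hl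
  have ht2 := mixing_le hl
  have hsq := one_le_sqrt_natCast hl
  have hlog := log_div_mixing_le hl hm
  have hpow := inv_one_sub_mixing_pow_le hl
  set t := mixing l
  have htm : 0 < t / m := by positivity
  have ht1 : 0 < 1 - t := by linarith
  have hsle : ∀ c, s c ≤ 1 := fun c => by
    rw [← hs1]; exact Finset.single_le_sum (fun y _ => hs y) (Finset.mem_univ c)
  have hppos : ∀ c, 0 < p c := fun c => htm.trans_le (hp c)
  have hPnn : ∀ c : Fin l → γ, 0 ≤ ∏ i, (if i = k then g else s) (c i) := fun c =>
    Finset.prod_nonneg fun i _ => by split_ifs; exacts [hg _, hs _]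
  -- Since u ≤ s / (1-t), the weights u may be replaced by s, under which mean and second moment are
  -- known; this is the source of the factor 2.
  have hdom : ∀ c : Fin l → γ, ∏ i, (if i = k then g else u) (c i)
      ≤ 2 * ∏ i, (if i = k then g else s) (c i) := by
    intro c
    calc ∏ i, (if i = k then g else u) (c i)
        ≤ ∏ i, ((1 - t)⁻¹ * (if i = k then g else s) (c i)) := by
          refine Finset.prod_le_prod (fun i _ => ?_) fun i _ => ?_
          · split_ifs; exacts [hg _, hu _]
          · rw [inv_mul_eq_div, le_div_iff₀ ht1]
            split_ifs
            · nlinarith [hg (c i)]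
            · linarith [hus (c i)]
      _ = (1 - t)⁻¹ ^ l * ∏ i, (if i = k then g else s) (c i) := by
          rw [Finset.prod_mul_distrib, Finset.prod_const, Finset.card_univ, Fintype.card_fin]
      _ ≤ _ := mul_le_mul_of_nonneg_right hpow (hPnn c)
  refine (Finset.sum_le_sum fun c _ => hdom c).trans ?_
  rw [← Finset.mul_sum]
  refine mul_le_mul_of_nonneg_left ?_ (by norm_num)
  have key := sum_update_prod_le s g hs hg hs1 hg1 k (fun c => Real.log (p c) - Real.log (s c))
    (θ := θ * √(l : ℝ)) (by positivity) hV S ?_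
  · refine key.trans_eq ?_
    rw [mul_pow, Real.sq_sqrt hl0.le, Fintype.card_fin]
    field_simp
  · intro c hc _
    rw [le_abs]
    right
    set μ := ∑ c, s c * (Real.log (p c) - Real.log (s c))
    have h1 := hS c hc
    have hpp : 0 < ∏ i, p (c i) := Finset.prod_pos fun i _ => hppos _
    have hsp : 0 < ∏ i, s (c i) := lt_trans (by positivity) h1
    have hsne : ∀ i, s (c i) ≠ 0 := fun i h0 =>
      hsp.ne' (Finset.prod_eq_zero (Finset.mem_univ i) h0)
    have h2 := Real.log_lt_log (by positivity) h1
    rw [Real.log_mul hpp.ne' (Real.exp_pos _).ne', Real.log_exp,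
      Real.log_prod fun i _ => (hppos (c i)).ne', Real.log_prod fun i _ => hsne i] at h2
    have h3 : ∑ i, (Real.log (p (c i)) - Real.log (s (c i)))
        = ∑ i, Real.log (p (c i)) - ∑ i, Real.log (s (c i)) := Finset.sum_sub_distrib ..
    rw [← Finset.add_sum_erase _ _ (Finset.mem_univ k)] at h3
    rw [Finset.sum_sub_distrib, Finset.sum_const, Finset.card_erase_of_mem (Finset.mem_univ k),
      Finset.card_univ, Fintype.card_fin, nsmul_eq_mul, Nat.cast_sub hl, Nat.cast_one]
    have h4 : -(2 * √(2 * m) * √(l : ℝ)) ≤ Real.log (p (c k)) - Real.log (s (c k)) := by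
      have h5 := Real.log_le_log htm (hp (c k))
      have h6 : Real.log (t / m) = -Real.log (m / t) := by rw [← Real.log_inv, inv_div]
      have h7 := Real.log_nonpos (hs (c k)) (hsle (c k))
      linarith
    -- Omitting position k loses one mean μ. If μ ≤ D the loss is at most D; otherwise μ > D ≥ h and
    -- (l-1)μ ≥ (l-1)h ≥ lh - D.
    have h8 : (l : ℝ) * h - E * √(l : ℝ) - D * √(l : ℝ) ≤ ((l : ℝ) - 1) * μ := by
      by_cases hμ : μ ≤ D
      · nlinarith
      · nlinarith
    nlinarith

/-- With p_j = (1-t)λ_j + t/m, split the bound (1-t)λ_j + t on the outcome marginal of s. The first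
part reproduces λ_j log λ_j since p_j ≥ (1-t)λ_j; the second costs at most t log (m/t) since p_j ≥
t/m. -/
lemma sum_mul_log_ge {m d : ℕ} (hm : 1 ≤ m) (lam : Fin m → ℝ) (hlam : ∀ j, 0 ≤ lam j)
    (hlam1 : ∑ j, lam j = 1) (s : Fin m × Fin d → ℝ)
    (hL : ∀ j, ∑ y, s (j, y) ≤ (1 - mixing l) * lam j + mixing l) :
    ∑ c, Real.negMulLog (s c) - ∑ j, Real.negMulLog (lam j) - 2 * mixing l
        - m * (mixing l * Real.log (m / mixing l))
      ≤ ∑ c, s c * (Real.log ((1 - mixing l) * lam c.1 + mixing l / m) - Real.log (s c)) := by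
  have hm0 : (0 : ℝ) < m := by exact_mod_cast hm
  have hm1 : (1 : ℝ) ≤ m := by exact_mod_cast hm
  have ht := mixing_pos hl
  have ht2 := mixing_le hl
  have hlog1 := log_one_sub_ge ht.le ht2
  set t := mixing l
  have htm : 0 < t / m := by positivity
  have htm1 : t / m ≤ t := div_le_self ht.le hm1
  have hlamle : ∀ j, lam j ≤ 1 := fun j => by
    rw [← hlam1]; exact Finset.single_le_sum (fun y _ => hlam y) (Finset.mem_univ j)
  have e1 : ∑ c, s c * (Real.log ((1 - t) * lam c.1 + t / m) - Real.log (s c))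
      = ∑ c, Real.negMulLog (s c)
        + ∑ j, (∑ y, s (j, y)) * Real.log ((1 - t) * lam j + t / m) := by
    simp only [Finset.sum_mul]
    rw [← Fintype.sum_prod_type' (f := fun j y => s (j, y) * Real.log ((1 - t) * lam j + t / m)),
      ← Finset.sum_add_distrib]
    refine Finset.sum_congr rfl fun c _ => ?_
    rw [Real.negMulLog]; ring
  rw [e1]
  have e2 : ∀ j, -Real.negMulLog (lam j) - 2 * t * lam j - t * Real.log (m / t)
      ≤ (∑ y, s (j, y)) * Real.log ((1 - t) * lam j + t / m) := by
    intro j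
    have hlj := hlam j
    have hp0 : t / m ≤ (1 - t) * lam j + t / m := by nlinarith
    have hp1 : (1 - t) * lam j + t / m ≤ 1 := by nlinarith [hlamle j]
    have hpn := Real.log_nonpos (htm.le.trans hp0) hp1
    have hA : t * -Real.log (m / t) ≤ t * Real.log ((1 - t) * lam j + t / m) := by
      have h6 : Real.log (t / m) = -Real.log (m / t) := by rw [← Real.log_inv, inv_div]
      rw [← h6]
      exact mul_le_mul_of_nonneg_left (Real.log_le_log htm hp0) ht.le
    have hB : -Real.negMulLog (lam j) - 2 * t * lam j
        ≤ (1 - t) * lam j * Real.log ((1 - t) * lam j + t / m) := by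
      rcases hlj.eq_or_lt with h0 | h0
      · simp [← h0]
      · have h7 : Real.log (1 - t) + Real.log (lam j) ≤ Real.log ((1 - t) * lam j + t / m) := by
          rw [← Real.log_mul (by linarith) h0.ne']
          exact Real.log_le_log (by nlinarith) (by linarith)
        have h8 := Real.log_nonpos hlj (hlamle j)
        have h9 : Real.log (1 - t) ≤ 0 := Real.log_nonpos (by linarith) (by linarith)
        have h10 := mul_le_mul_of_nonneg_left h7
          (show (0 : ℝ) ≤ (1 - t) * lam j by nlinarith)
        rw [Real.negMulLog]
        have h11 : lam j * (Real.log (1 - t) + Real.log (lam j))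
            ≤ (1 - t) * lam j * (Real.log (1 - t) + Real.log (lam j)) := by
          have : t * lam j * (Real.log (1 - t) + Real.log (lam j)) ≤ 0 :=
            mul_nonpos_of_nonneg_of_nonpos (by positivity) (by linarith)
          linarith
        have h12 := mul_le_mul_of_nonneg_left hlog1 hlj
        linarith
    have hC := mul_le_mul_of_nonpos_right (hL j) hpn
    linarith
  have e3 := Finset.sum_le_sum fun j (_ : j ∈ Finset.univ) => e2 j
  simp only [Finset.sum_sub_distrib, Finset.sum_neg_distrib, ← Finset.mul_sum, hlam1, mul_one,
    Finset.sum_const, Finset.card_univ, Fintype.card_fin, nsmul_eq_mul] at e3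
  linarith

lemma sum_mul_log_sq_le {m d : ℕ} (hm : 1 ≤ m) (lam : Fin m → ℝ) (hlam : ∀ j, 0 ≤ lam j)
    (hlam1 : ∑ j, lam j = 1) (s : Fin m × Fin d → ℝ) (hs : ∀ c, 0 ≤ s c) (hs1 : ∀ c, s c ≤ 1)
    (hL : ∀ j, ∑ y, s (j, y) ≤ (1 - mixing l) * lam j + mixing l) :
    ∑ c, s c * (Real.log ((1 - mixing l) * lam c.1 + mixing l / m) - Real.log (s c)) ^ 2
      ≤ 2 * (m * (4 + 4 * m)) + 8 * (m * d) := by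
  have hm0 : (0 : ℝ) < m := by exact_mod_cast hm
  have hm1 : (1 : ℝ) ≤ m := by exact_mod_cast hm
  have ht := mixing_pos hl
  have ht2 := mixing_le hl
  set t := mixing l
  have htm : 0 < t / m := by positivity
  have htm1 : t / m ≤ t := div_le_self ht.le hm1
  have hlamle : ∀ j, lam j ≤ 1 := fun j => by
    rw [← hlam1]; exact Finset.single_le_sum (fun y _ => hlam y) (Finset.mem_univ j)
  have e2 : ∀ j, (∑ y, s (j, y)) * Real.log ((1 - t) * lam j + t / m) ^ 2 ≤ 4 + 4 * m := by
    intro j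
    have hlj := hlam j
    have hp0 : t / m ≤ (1 - t) * lam j + t / m := by nlinarith
    have hp1 : (1 - t) * lam j + t / m ≤ 1 := by nlinarith [hlamle j]
    have hpn := Real.log_nonpos (htm.le.trans hp0) hp1
    have hmono : ∀ x, 0 < x → x ≤ (1 - t) * lam j + t / m →
        Real.log ((1 - t) * lam j + t / m) ^ 2 ≤ Real.log x ^ 2 := by
      intro x hx0 hx
      have := Real.log_le_log hx0 hx
      nlinarith
    have hA : t * Real.log ((1 - t) * lam j + t / m) ^ 2 ≤ 4 * m := by
      have h1 := mul_log_sq_le htm.le (by linarith)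
      have h2 := mul_le_mul_of_nonneg_left (hmono _ htm hp0) ht.le
      have h3 : t * Real.log (t / m) ^ 2 = m * (t / m * Real.log (t / m) ^ 2) := by field_simp
      nlinarith
    have hB : (1 - t) * lam j * Real.log ((1 - t) * lam j + t / m) ^ 2 ≤ 4 := by
      rcases hlj.eq_or_lt with h0 | h0
      · simp [← h0]
      · have hu : 0 < (1 - t) * lam j := mul_pos (by linarith) h0
        have h1 := mul_log_sq_le hu.le (by linarith)
        have h2 := mul_le_mul_of_nonneg_left (hmono _ hu (by linarith)) hu.le
        linarith
    have hC := mul_le_mul_of_nonneg_right (hL j)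
      (sq_nonneg (Real.log ((1 - t) * lam j + t / m)))
    linarith
  calc ∑ c, s c * (Real.log ((1 - t) * lam c.1 + t / m) - Real.log (s c)) ^ 2
      ≤ ∑ c, (2 * (s c * Real.log ((1 - t) * lam c.1 + t / m) ^ 2) + 8) := by
        refine Finset.sum_le_sum fun c _ => ?_
        have h1 := mul_log_sq_le (hs c) (hs1 c)
        have h2 : (Real.log ((1 - t) * lam c.1 + t / m) - Real.log (s c)) ^ 2
            ≤ 2 * Real.log ((1 - t) * lam c.1 + t / m) ^ 2 + 2 * Real.log (s c) ^ 2 := by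
          nlinarith [sq_nonneg (Real.log ((1 - t) * lam c.1 + t / m) + Real.log (s c))]
        have h3 := mul_le_mul_of_nonneg_left h2 (hs c)
        linarith
    _ = 2 * ∑ j, (∑ y, s (j, y)) * Real.log ((1 - t) * lam j + t / m) ^ 2 + 8 * (m * d) := by
        rw [Finset.sum_add_distrib, ← Finset.mul_sum]
        congr 1
        · simp only [Finset.sum_mul]
          rw [Fintype.sum_prod_type]
        · simp; ring
    _ ≤ _ := by
        have := Finset.sum_le_sum fun j (_ : j ∈ Finset.univ) => e2 j
        rw [Finset.sum_const, Finset.card_univ, Fintype.card_fin, nsmul_eq_mul] at this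
        linarith

end Tails

/-! ### Sampling a resolution and truncating the sample. -/

section Sampling

variable {n : Type} [Fintype n] [DecidableEq n] {W : Type*} [Fintype W]

lemma hsSq_smul (A : Matrix n n ℂ) (c : ℝ) : hsSq (c • A) = c ^ 2 * hsSq A := by
  simp only [hsSq, Finset.mul_sum, Matrix.smul_apply, norm_smul, mul_pow, Real.norm_eq_abs, sq_abs]

lemma ev_mul_self_eq_hsSq {Ω D : Matrix n n ℂ} (hD : D.IsHermitian) :
    ev (Ωᴴ * Ω) (D * D) = hsSq (Ω * D) := by
  have := ev_conj_eq_hsSq Ω D 1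
  simpa [hD.eq] using this

/-- Empirical averages of the matrices `χ κ J • X J` approximate their means in weighted
Hilbert-Schmidt norms, simultaneously for all `κ`. -/
lemma exists_sample {K : Type*} [Fintype K] (p : W → ℝ) (hp : ∀ J, 0 ≤ p J) (hp1 : ∑ J, p J = 1)
    (X : W → Matrix n n ℂ) (hX : ∀ J, (X J).PosSemidef) {B : ℝ} (hB : 0 ≤ B)
    (hXB : ∀ J, X J * X J ≤ B • X J) (hG : ∑ J, p J • X J ≤ 1)
    (ω : K → Matrix n n ℂ) (hω : ∀ κ, (ω κ).PosSemidef) {τ : ℝ} (hτ : ∀ κ, (ω κ).trace.re ≤ τ)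
    (χ : K → W → ℝ) (hχ : ∀ κ J, 0 ≤ χ κ J) (hχ1 : ∀ κ J, χ κ J ≤ 1) (M : ℕ) (hM : 1 ≤ M) :
    ∃ w : Fin M → W, ∀ κ, ev (ω κ)
      (((M : ℝ)⁻¹ • ∑ μ, χ κ (w μ) • X (w μ) - ∑ J, p J • χ κ J • X J) *
        ((M : ℝ)⁻¹ • ∑ μ, χ κ (w μ) • X (w μ) - ∑ J, p J • χ κ J • X J))
      ≤ Fintype.card K * τ * B / M := by
  have hM0 : (0 : ℝ) < M := by exact_mod_cast hM
  choose Ω hΩ using fun κ => exists_conjTranspose_mul_self (hω κ)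
  -- One vector collects the weighted matrices for all κ, so a single sample serves them all; the
  -- price is the factor `Fintype.card K`.
  let x : W → EuclideanSpace ℂ (K × n × n) := fun J =>
    WithLp.toLp 2 fun q => (Ω q.1 * (χ q.1 J • X J)) q.2.1 q.2.2
  obtain ⟨w, hw⟩ := exists_empirical p hp hp1 x M
  refine ⟨w, ?_⟩
  have hnorm : ∀ J, ‖x J‖ ^ 2 ≤ ∑ κ, B * ev (ω κ) (X J) := by
    intro J
    rw [EuclideanSpace.norm_sq_eq, Fintype.sum_prod_type]
    refine Finset.sum_le_sum fun κ _ => ?_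
    rw [Fintype.sum_prod_type]
    change hsSq (Ω κ * (χ κ J • X J)) ≤ _
    rw [mul_smul_comm, hsSq_smul, ← ev_mul_self_eq_hsSq (hX J).1, ← hΩ]
    have h1 : ev (ω κ) (X J * X J) ≤ B * ev (ω κ) (X J) := by
      rw [← ev_smul]; exact ev_mono (hω κ) (hXB J)
    have h2 : 0 ≤ ev (ω κ) (X J * X J) := by
      refine ev_nonneg (hω κ) ?_
      have := posSemidef_self_mul_conjTranspose (X J)
      rwa [(hX J).1.eq] at this
    have h3 : χ κ J ^ 2 ≤ 1 := pow_le_one₀ (hχ κ J) (hχ1 κ J)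
    nlinarith
  have htotal : ∑ J, p J * ‖x J‖ ^ 2 ≤ Fintype.card K * τ * B := by
    calc ∑ J, p J * ‖x J‖ ^ 2 ≤ ∑ J, p J * ∑ κ, B * ev (ω κ) (X J) :=
          Finset.sum_le_sum fun J _ => mul_le_mul_of_nonneg_left (hnorm J) (hp J)
      _ = ∑ κ, B * ev (ω κ) (∑ J, p J • X J) := by
          simp only [ev_sum, ev_smul, Finset.mul_sum]
          rw [Finset.sum_comm]
          exact Finset.sum_congr rfl fun κ _ => Finset.sum_congr rfl fun J _ => by ring
      _ ≤ ∑ _κ : K, B * τ := by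
          refine Finset.sum_le_sum fun κ _ => mul_le_mul_of_nonneg_left ?_ hB
          refine (ev_mono (hω κ) hG).trans ?_
          rw [ev_one]; exact hτ κ
      _ = _ := by simp; ring
  set D : K → Matrix n n ℂ := fun κ =>
    (M : ℝ)⁻¹ • ∑ μ, χ κ (w μ) • X (w μ) - ∑ J, p J • χ κ J • X J with hD
  have hDh : ∀ κ, (D κ).IsHermitian := by
    intro κ
    refine IsHermitian.sub ?_ ?_
    · exact (PosSemidef.smul (posSemidef_sum _ fun μ _ => (hX _).smul (hχ κ _))
        (inv_nonneg.2 hM0.le)).1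
    · exact (posSemidef_sum _ fun J _ => ((hX J).smul (hχ κ J)).smul (hp J)).1
  have hsum : ∑ μ, (x (w μ) - ∑ v, (p v : ℂ) • x v)
      = WithLp.toLp 2 fun q => (Ω q.1 * ((M : ℝ) • D q.1)) q.2.1 q.2.2 := by
    ext q
    have e : (M : ℝ) • D q.1 = ∑ μ : Fin M, χ q.1 (w μ) • X (w μ)
        - (M : ℝ) • ∑ J, p J • χ q.1 J • X J := by
      rw [hD]; simp only [smul_sub, smul_smul]; rw [mul_inv_cancel₀ hM0.ne', one_smul]
    change _ = (Ω q.1 * ((M : ℝ) • D q.1)) q.2.1 q.2.2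
    rw [e]
    simp [x, Matrix.mul_sub, Matrix.mul_sum, Matrix.sum_apply]
  have hfin : ‖∑ μ, (x (w μ) - ∑ v, (p v : ℂ) • x v)‖ ^ 2
      = (M : ℝ) ^ 2 * ∑ κ, ev (ω κ) (D κ * D κ) := by
    rw [hsum, EuclideanSpace.norm_sq_eq, Fintype.sum_prod_type, Finset.mul_sum]
    refine Finset.sum_congr rfl fun κ _ => ?_
    rw [Fintype.sum_prod_type]
    change hsSq (Ω κ * ((M : ℝ) • D κ)) = _
    rw [mul_smul_comm, hsSq_smul, ← ev_mul_self_eq_hsSq (hDh κ), ← hΩ]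
  rw [hfin] at hw
  intro κ
  have hκ : ev (ω κ) (D κ * D κ) ≤ ∑ κ, ev (ω κ) (D κ * D κ) := by
    refine Finset.single_le_sum (f := fun κ => ev (ω κ) (D κ * D κ)) (fun κ _ => ?_)
      (Finset.mem_univ κ)
    have h := posSemidef_self_mul_conjTranspose (D κ)
    rw [(hDh κ).eq] at h
    exact ev_nonneg (hω κ) h
  refine le_trans hκ ?_
  rw [le_div_iff₀ hM0]
  have h4 := mul_le_mul_of_nonneg_left htotal hM0.le
  have h5 : (M : ℝ) * ((∑ κ, ev (ω κ) (D κ * D κ)) * M) ≤ M * (Fintype.card K * τ * B) := by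
    linarith
  exact le_of_mul_le_mul_left h5 hM0

lemma posSemidef_mul_self {A : Matrix n n ℂ} (hA : A.IsHermitian) : (A * A).PosSemidef := by
  have h := posSemidef_self_mul_conjTranspose A
  rwa [hA.eq] at h

/-- If `S` is close to some `G ≤ 1` then a truncation makes `S` a subnormalized resolution without
changing expectation values much. -/
lemma exists_truncated {S G : Matrix n n ℂ} (hS : S.PosSemidef) (hG : G.PosSemidef) (hG1 : G ≤ 1) :
    ∃ T : Matrix n n ℂ, T.IsHermitian ∧ T * S * T ≤ 1 ∧
      ∀ (σ Y E : Matrix n n ℂ) (δ : ℝ), σ.PosSemidef → σ.trace = 1 → δ ≤ 1 →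
        Y.PosSemidef → E.IsHermitian → Y ≤ S → ev σ ((S - G) * (S - G)) ≤ δ →
        ev σ ((Y - E) * (Y - E)) ≤ δ → |ev σ (T * Y * T) - ev σ E| ≤ 4 * √δ := by
  have hΔh : (S - G).IsHermitian := hS.1.sub hG.1
  obtain ⟨T, hT, hT1, hT2⟩ := exists_truncation hΔh
  -- Here G ≤ 1 enters: both bounds of `exists_truncation` for Δ = S - G pass to every Y ≤ S.
  have hS1 : S ≤ 1 + (S - G) := by
    have : 1 + (S - G) = S + (1 - G) := by abel
    rw [this]
    exact le_add_of_nonneg_right (sub_nonneg.2 hG1)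
  have hconj : ∀ {Y : Matrix n n ℂ}, Y ≤ S → T * Y * T ≤ T * (1 + (S - G)) * T := by
    intro Y hY
    have := conj_mono (hY.trans hS1) T
    rwa [hT.eq] at this
  have hT1h : (T - 1)ᴴ = T - 1 := by rw [conjTranspose_sub, hT.eq, conjTranspose_one]
  have hconj2 : ∀ {Y : Matrix n n ℂ}, Y ≤ S →
      (T - 1) * Y * (T - 1) ≤ (T - 1) * (1 + (S - G)) * (T - 1) := by
    intro Y hY
    have := conj_mono (hY.trans hS1) (T - 1)
    rwa [hT1h] at this
  refine ⟨T, hT, (hconj le_rfl).trans hT1, ?_⟩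
  intro σ Y E δ hσ hσ1 hδ1 hY hE hYS hΔ hD
  have hsqrt1 : √δ ≤ 1 := Real.sqrt_le_one.2 hδ1
  have h1 : |ev σ Y - ev σ E| ≤ √δ := by
    rw [← ev_sub]
    exact (abs_ev_le_sqrt hσ hσ1 (hY.1.sub hE)).trans (Real.sqrt_le_sqrt hD)
  have h2 : |ev σ (S - G)| ≤ √δ :=
    (abs_ev_le_sqrt hσ hσ1 hΔh).trans (Real.sqrt_le_sqrt hΔ)
  have hone : ev σ 1 = 1 := by rw [ev_one, hσ1, Complex.one_re]
  have h3 : ev σ Y ≤ 4 := by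
    have h := ev_mono hσ (hYS.trans hS1)
    rw [ev_add, hone] at h
    have := le_abs_self (ev σ (S - G))
    linarith
  have h4 : ev σ (T * Y * T) ≤ 1 := by
    rw [← hone]; exact ev_mono hσ ((hconj hYS).trans hT1)
  have h5 : ev σ ((T - 1) * Y * (T - 1)) ≤ δ :=
    (ev_mono hσ ((hconj2 hYS).trans hT2)).trans hΔ
  have h6 := abs_ev_conj_sub_le hσ hY T
  rw [hT1h, hT.eq] at h6
  have h7 : √(ev σ (T * Y * T)) ≤ 1 := Real.sqrt_le_one.2 h4
  have h8 : √(ev σ Y) ≤ 2 := Real.sqrt_le_iff.2 ⟨by norm_num, by norm_num; exact h3⟩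
  have h9 := Real.sqrt_le_sqrt h5
  have h10 : |ev σ (T * Y * T) - ev σ Y| ≤ √δ * 3 :=
    h6.trans (mul_le_mul h9 (by linarith) (by positivity) (Real.sqrt_nonneg _))
  have h11 := abs_sub_le (ev σ (T * Y * T)) (ev σ Y) (ev σ E)
  linarith

/-- Compression: a resolution `∑ p J • X J ≤ 1` of operators with `X² ≤ B X` is approximated by
about `B` of its members. -/
lemma exists_compressed {K C : Type*} [Fintype K] [Fintype C] (p : W → ℝ) (hp : ∀ J, 0 ≤ p J)
    (hp1 : ∑ J, p J = 1) (X : W → Matrix n n ℂ) (hX : ∀ J, (X J).PosSemidef) {B : ℝ} (hB : 0 ≤ B)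
    (hXB : ∀ J, X J * X J ≤ B • X J) (hG : ∑ J, p J • X J ≤ 1)
    (ω : K → Matrix n n ℂ) (hω : ∀ κ, (ω κ).PosSemidef) {τ : ℝ} (hτ : ∀ κ, (ω κ).trace.re ≤ τ)
    (χ : K → C → W → ℝ) (hχ : ∀ κ c J, 0 ≤ χ κ c J) (hχ1 : ∀ κ c J, χ κ c J ≤ 1)
    {δ : ℝ} (hδ1 : δ ≤ 1) (M : ℕ) (hM : 1 ≤ M)
    (hδ : Fintype.card K * (Fintype.card C + 1) * τ * B ≤ δ * M) :
    ∃ (w : Fin M → W) (A : Fin M → Matrix n n ℂ), (∀ μ, (A μ).PosSemidef) ∧ ∑ μ, A μ ≤ 1 ∧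
      ∀ κ c (σ : Matrix n n ℂ), σ.PosSemidef → σ.trace = 1 → σ ≤ ω κ →
        |ev σ (∑ μ, χ κ c (w μ) • A μ) - ev σ (∑ J, p J • χ κ c J • X J)| ≤ 4 * √δ := by
  have hM0 : (0 : ℝ) < M := by exact_mod_cast hM
  have hMi : (0 : ℝ) ≤ (M : ℝ)⁻¹ := inv_nonneg.2 hM0.le
  -- The index `none` carries the total sum, which the truncation has to control, and `some c` the
  -- partial sums; hence the + 1 in the condition on M.
  obtain ⟨w, hw⟩ := exists_sample (K := K × Option C) p hp hp1 X hX hB hXB hG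
    (fun κ => ω κ.1) (fun κ => hω κ.1) (fun κ => hτ κ.1)
    (fun κ => κ.2.elim (fun _ => 1) (χ κ.1))
    (by rintro ⟨κ, _ | c⟩ J; exacts [zero_le_one, hχ κ c J])
    (by rintro ⟨κ, _ | c⟩ J; exacts [le_rfl, hχ1 κ c J]) M hM
  have hbound : (Fintype.card (K × Option C) : ℝ) * τ * B / M ≤ δ := by
    rw [div_le_iff₀ hM0]
    simpa using hδ
  have hBS : ∀ κ c, (M : ℝ)⁻¹ • ∑ μ, χ κ c (w μ) • X (w μ) ≤ (M : ℝ)⁻¹ • ∑ μ, X (w μ) := by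
    intro κ c
    refine smul_mono (Finset.sum_le_sum fun μ _ => ?_) hMi
    rw [le_iff]
    have : X (w μ) - χ κ c (w μ) • X (w μ) = (1 - χ κ c (w μ)) • X (w μ) := by
      rw [sub_smul, one_smul]
    rw [this]
    exact (hX _).smul (sub_nonneg.2 (hχ1 κ c _))
  have hSpsd : ((M : ℝ)⁻¹ • ∑ μ, X (w μ)).PosSemidef :=
    PosSemidef.smul (posSemidef_sum _ fun μ _ => hX _) hMi
  have hGpsd : (∑ J, p J • X J).PosSemidef := posSemidef_sum _ fun J _ => (hX J).smul (hp J)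
  have hBpsd : ∀ κ c, ((M : ℝ)⁻¹ • ∑ μ, χ κ c (w μ) • X (w μ)).PosSemidef := fun κ c =>
    PosSemidef.smul (posSemidef_sum _ fun μ _ => (hX _).smul (hχ κ c _)) hMi
  have hEpsd : ∀ κ c, (∑ J, p J • χ κ c J • X J).PosSemidef := fun κ c =>
    posSemidef_sum _ fun J _ => ((hX J).smul (hχ κ c J)).smul (hp J)
  obtain ⟨T, hT, hT1, hT2⟩ := exists_truncated hSpsd hGpsd hG
  refine ⟨w, fun μ => (M : ℝ)⁻¹ • (T * X (w μ) * T), ?_, ?_, ?_⟩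
  · intro μ
    have h := (hX (w μ)).mul_mul_conjTranspose_same T
    rw [hT.eq] at h
    exact h.smul hMi
  · have e : ∑ μ, (M : ℝ)⁻¹ • (T * X (w μ) * T) = T * ((M : ℝ)⁻¹ • ∑ μ, X (w μ)) * T := by
      rw [← Finset.smul_sum, ← Matrix.sum_mul, ← Matrix.mul_sum, mul_smul_comm, smul_mul_assoc]
    rw [e]
    exact hT1
  · intro κ c σ hσ hσ1 hσω
    have e : ∑ μ, χ κ c (w μ) • (M : ℝ)⁻¹ • (T * X (w μ) * T)
        = T * ((M : ℝ)⁻¹ • ∑ μ, χ κ c (w μ) • X (w μ)) * T := by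
      simp only [mul_smul_comm, smul_mul_assoc, Matrix.sum_mul, Matrix.mul_sum, Finset.smul_sum]
      exact Finset.sum_congr rfl fun μ _ => smul_comm _ _ _
    rw [e]
    have hsq : ∀ {Y : Matrix n n ℂ}, Y.IsHermitian → ev (ω κ) (Y * Y) ≤ δ → ev σ (Y * Y) ≤ δ :=
      fun hY h => (ev_mono_left (posSemidef_mul_self hY) hσω).trans h
    refine hT2 σ _ _ δ hσ hσ1 hδ1 (hBpsd κ c) (hEpsd κ c).1 (hBS κ c) ?_ ?_
    · refine hsq (hSpsd.1.sub hGpsd.1) ?_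
      have h := (hw (κ, none)).trans hbound
      simpa only [Option.elim, one_smul] using h
    · exact hsq ((hBpsd κ c).1.sub (hEpsd κ c).1) ((hw (κ, some c)).trans hbound)

end Sampling

/-! ### Operators cut by projections. -/

section Cut

variable {n : Type} [Fintype n] [DecidableEq n]

lemma isHermitian_ofReal_diagonal (f : n → ℝ) :
    (diagonal fun i => (f i : ℂ)).IsHermitian := by
  simp [IsHermitian, diagonal_conjTranspose, Pi.star_def]

lemma ofReal_diagonal_le {f g : n → ℝ} (h : ∀ i, f i ≤ g i) :
    (diagonal fun i => (f i : ℂ)) ≤ diagonal fun i => (g i : ℂ) := by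
  rw [le_iff, diagonal_sub]
  refine PosSemidef.diagonal fun i => ?_
  simpa using h i

lemma smul_one_eq_diagonal (c : ℝ) : c • (1 : Matrix n n ℂ) = diagonal fun _ => (c : ℂ) := by
  ext i j
  by_cases h : i = j
  · subst h; simp
  · simp [h]

/-- The operator `c • P N D Nᴴ P` cut by projections `P` and `D` satisfies `X² ≤ c e₁ e₂ X`. -/
lemma cut_mul_self_le {P R N : Matrix n n ℂ} (hP : P.IsHermitian) (hPP : P * P = P)
    {e₁ e₂ c : ℝ} (he₁ : 0 ≤ e₁) (hPR : P ≤ e₁ • R) {s f : n → ℝ}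
    (hN : Nᴴ * R * N = diagonal fun i => (s i : ℂ)) (hf : ∀ i, f i * f i = f i)
    (hs : ∀ i, f i * s i ≤ e₂) :
    (c • (P * (N * diagonal (fun i => (f i : ℂ)) * Nᴴ) * P)) *
        (c • (P * (N * diagonal (fun i => (f i : ℂ)) * Nᴴ) * P))
      ≤ (c * c * (e₁ * e₂)) • (P * (N * diagonal (fun i => (f i : ℂ)) * Nᴴ) * P) := by
  set D : Matrix n n ℂ := diagonal (fun i => (f i : ℂ)) with hD
  have hDh : Dᴴ = D := isHermitian_ofReal_diagonal f
  have hDD : D * D = D := by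
    rw [hD, diagonal_mul_diagonal]
    congr 1
    ext i
    rw [← Complex.ofReal_mul, hf]
  set Q := P * N * D with hQ
  have hY : P * (N * D * Nᴴ) * P = Q * Qᴴ := by
    rw [hQ]
    simp only [conjTranspose_mul, hDh, hP.eq]
    calc P * (N * D * Nᴴ) * P = P * (N * (D * D) * Nᴴ) * P := by rw [hDD]
      _ = _ := by simp only [mul_assoc]
  -- The operator is Q Qᴴ and its square Q (Qᴴ Q) Qᴴ, so a bound on Qᴴ Q = D Nᴴ P N D suffices; P ≤
  -- e₁ R reduces it to the diagonal matrix Nᴴ R N cut by D.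
  have h1 : Qᴴ * Q ≤ (e₁ * e₂) • 1 := by
    have e : Qᴴ * Q = (N * D)ᴴ * P * (N * D) := by
      rw [hQ]
      simp only [conjTranspose_mul, hDh, hP.eq]
      calc D * (Nᴴ * P) * (P * N * D) = D * Nᴴ * (P * P) * N * D := by simp only [mul_assoc]
        _ = _ := by rw [hPP]; simp only [mul_assoc]
    rw [e]
    refine (conj_mono' hPR (N * D)).trans ?_
    have e2 : (N * D)ᴴ * (e₁ • R) * (N * D) = e₁ • (D * (Nᴴ * R * N) * D) := by
      rw [conjTranspose_mul, hDh, mul_smul_comm, smul_mul_assoc]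
      simp only [mul_assoc]
    rw [e2, mul_smul]
    refine smul_mono ?_ he₁
    rw [hN, hD, diagonal_mul_diagonal, diagonal_mul_diagonal, smul_one_eq_diagonal]
    simp only [← Complex.ofReal_mul]
    refine ofReal_diagonal_le fun i => ?_
    calc f i * s i * f i = f i * f i * s i := by ring
      _ ≤ e₂ := by rw [hf]; exact hs i
  rw [hY]
  have h2 := conj_mono h1 Q
  have e3 : (c • (Q * Qᴴ)) * (c • (Q * Qᴴ)) = (c * c) • (Q * (Qᴴ * Q) * Qᴴ) := by
    rw [smul_mul_assoc, mul_smul_comm, smul_smul]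
    simp only [mul_assoc]
  have e4 : Q * ((e₁ * e₂) • (1 : Matrix n n ℂ)) * Qᴴ = (e₁ * e₂) • (Q * Qᴴ) := by
    rw [mul_smul_comm, smul_mul_assoc, mul_one]
  rw [e4] at h2
  rw [e3, mul_smul (c * c)]
  exact smul_mono h2 (mul_self_nonneg c)

lemma conj_diagonal_posSemidef (N : Matrix n n ℂ) {f : n → ℝ} (hf : ∀ i, 0 ≤ f i) :
    (N * diagonal (fun i => (f i : ℂ)) * Nᴴ).PosSemidef := by
  refine PosSemidef.mul_mul_conjTranspose_same (PosSemidef.diagonal fun i => ?_) N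
  simpa using hf i

/-- Conjugating with a projection `P` of nearly full expectation changes expectations little. -/
lemma abs_ev_projection_sub_le {σ P Y : Matrix n n ℂ} (hσ : σ.PosSemidef) (hσ1 : σ.trace = 1)
    (hP : P.IsHermitian) (hPP : P * P = P) (hY : Y.PosSemidef) (hY1 : Y ≤ 1) {δ : ℝ}
    (hδ : ev σ (1 - P) ≤ δ) : |ev σ (P * Y * P) - ev σ Y| ≤ 2 * √δ := by
  have hone : ev σ 1 = 1 := by rw [ev_one, hσ1, Complex.one_re]
  have h := abs_ev_conj_sub_le hσ hY P
  have hPh : (P - 1)ᴴ = P - 1 := by rw [conjTranspose_sub, hP.eq, conjTranspose_one]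
  rw [hP.eq, hPh] at h
  have h1 : (P - 1) * Y * (P - 1) ≤ 1 - P := by
    have := conj_mono hY1 (P - 1)
    rw [hPh] at this
    refine this.trans_eq ?_
    rw [mul_one, mul_sub, sub_mul, hPP]
    simp
  have hP1 : P ≤ 1 := by
    rw [le_iff]
    have e : 1 - P = (P - 1) * (P - 1)ᴴ := by
      rw [hPh, mul_sub, sub_mul, hPP]; simp
    rw [e]
    exact posSemidef_self_mul_conjTranspose _
  have h2 : ev σ (P * Y * P) ≤ 1 := by
    have h3 := conj_mono hY1 P
    rw [hP.eq, mul_one, hPP] at h3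
    rw [← hone]; exact ev_mono hσ (h3.trans hP1)
  have h3 : ev σ Y ≤ 1 := by rw [← hone]; exact ev_mono hσ hY1
  have h4 := Real.sqrt_le_sqrt ((ev_mono hσ h1).trans hδ)
  have h5 := Real.sqrt_le_one.2 h2
  have h6 := Real.sqrt_le_one.2 h3
  calc _ ≤ _ := h
    _ ≤ √δ * 2 := mul_le_mul h4 (by linarith) (by positivity) (Real.sqrt_nonneg _)
    _ = _ := mul_comm _ _

end Cut

/-! ### Product operators as classical distributions on words. -/

section Word

variable {l d : ℕ}

lemma diag_re_nonneg {n : Type} [Fintype n] {A : Matrix n n ℂ} (hA : A.PosSemidef) (i : n) :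
    0 ≤ (A i i).re :=
  (Complex.le_def.1 (hA.diag_nonneg (i := i))).1

lemma diag_ofReal_re {n : Type} [Fintype n] {A : Matrix n n ℂ} (hA : A.PosSemidef) (i : n) :
    (((A i i).re : ℝ) : ℂ) = A i i :=
  Complex.ext rfl (Complex.le_def.1 (hA.diag_nonneg (i := i))).2

/-- The passage from quantum to classical: the expectation of a cut operator is a sum of product
weights over words, to which the tail bounds apply. -/
lemma ev_tensor_conj_diagonal {F N : Fin l → Matrix (Fin d) (Fin d) ℂ}
    (hF : ∀ i, (F i).PosSemidef) (f : (Fin l → Fin d) → ℝ) :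
    ev (tensor F) (tensor N * diagonal (fun y => (f y : ℂ)) * (tensor N)ᴴ)
      = ∑ y, f y * ∏ i, (((N i)ᴴ * F i * N i) (y i) (y i)).re := by
  have e : (tensor F * (tensor N * diagonal (fun y => (f y : ℂ)) * (tensor N)ᴴ)).trace
      = (tensor (fun i => (N i)ᴴ * F i * N i) * diagonal (fun y => (f y : ℂ))).trace := by
    have : tensor (fun i => (N i)ᴴ * F i * N i) = (tensor N)ᴴ * tensor F * tensor N := by
      rw [tensor_conjTranspose, tensor_mul, tensor_mul]
    rw [this, ← mul_assoc, trace_mul_comm]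
    simp only [mul_assoc]
  rw [ev, e, trace, Complex.re_sum]
  refine Finset.sum_congr rfl fun y _ => ?_
  rw [diag_apply, mul_diagonal, tensor, of_apply]
  have h2 : ∏ i, ((N i)ᴴ * F i * N i) (y i) (y i)
      = ((∏ i, (((N i)ᴴ * F i * N i) (y i) (y i)).re : ℝ) : ℂ) := by
    rw [Complex.ofReal_prod]
    exact Finset.prod_congr rfl fun i _ =>
      (diag_ofReal_re ((hF i).conjTranspose_mul_mul_same (N i)) (y i)).symm
  rw [h2, ← Complex.ofReal_mul, Complex.ofReal_re, mul_comm]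

lemma update_posSemidef {ρ A : Matrix (Fin d) (Fin d) ℂ} (hρ : ρ.PosSemidef) (hA : A.PosSemidef)
    (k i : Fin l) : (Function.update (fun _ => ρ) k A i).PosSemidef := by
  by_cases h : i = k
  · subst h; simpa using hA
  · simpa [Function.update_of_ne h] using hρ

lemma trace_tensor_update {ρ A : Matrix (Fin d) (Fin d) ℂ} (hρ : ρ.trace = 1) (k : Fin l) :
    (tensor (Function.update (fun _ => ρ) k A)).trace = A.trace := by
  rw [trace_tensor, Finset.prod_eq_single k]
  · simp
  · intro i _ hi; simp [Function.update_of_ne hi, hρ]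
  · simp

lemma ev_tensor_update_update {ρ A B : Matrix (Fin d) (Fin d) ℂ} (hρ : ρ.trace = 1) (k : Fin l) :
    ev (tensor (Function.update (fun _ => ρ) k A)) (tensor (Function.update (fun _ => 1) k B))
      = ev A B := by
  have e : (fun i => Function.update (fun _ : Fin l => ρ) k A i
      * Function.update (fun _ : Fin l => (1 : Matrix (Fin d) (Fin d) ℂ)) k B i)
      = Function.update (fun _ => ρ) k (A * B) := by
    ext1 i
    by_cases h : i = k
    · subst h; simp
    · simp [Function.update_of_ne h]
  rw [ev, tensor_mul, e, trace_tensor_update hρ, ev]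

/-- The diagonal weights of a product operator which is `ρ` except at one position. -/
lemma re_conj_update_apply (ρ A : Matrix (Fin d) (Fin d) ℂ) {γ : Type*} (k i : Fin l)
    (N : γ → Matrix (Fin d) (Fin d) ℂ) (c : γ × Fin d) :
    (((N c.1)ᴴ * Function.update (fun _ : Fin l => ρ) k A i * N c.1) c.2 c.2).re
      = (if i = k then (fun c : γ × Fin d => (((N c.1)ᴴ * A * N c.1) c.2 c.2).re)
          else fun c => (((N c.1)ᴴ * ρ * N c.1) c.2 c.2).re) c := by
  by_cases h : i = k
  · subst h; simp
  · simp [h]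

lemma sum_diag_conj {m : ℕ} {a N : Fin m → Matrix (Fin d) (Fin d) ℂ}
    (hN : ∀ j, a j = N j * (N j)ᴴ) (F : Matrix (Fin d) (Fin d) ℂ) (j : Fin m) :
    ∑ y, (((N j)ᴴ * F * N j) y y).re = ev F (a j) := by
  rw [← Complex.re_sum]
  change ((N j)ᴴ * F * N j).trace.re = _
  rw [ev, hN, mul_assoc, trace_mul_comm, mul_assoc]

lemma sum_diag_conj_povm {m : ℕ} {a N : Fin m → Matrix (Fin d) (Fin d) ℂ} (ha : IsPOVM a)
    (hN : ∀ j, a j = N j * (N j)ᴴ) (F : Matrix (Fin d) (Fin d) ℂ) :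
    ∑ c : Fin m × Fin d, (((N c.1)ᴴ * F * N c.1) c.2 c.2).re = F.trace.re := by
  rw [Fintype.sum_prod_type]
  simp only [sum_diag_conj hN]
  rw [← ev_sum, ha.sum_eq_one, ev_one]

lemma trace_povm_le {m : ℕ} {a : Fin m → Matrix (Fin d) (Fin d) ℂ} (ha : IsPOVM a) (j : Fin m) :
    (a j).trace.re ≤ d := by
  have h : a j ≤ 1 := by
    rw [← ha.sum_eq_one]
    exact Finset.single_le_sum (fun i _ => (ha.posSemidef i).nonneg) (Finset.mem_univ j)
  have := ev_mono (PosSemidef.one (n := Fin d) (R := ℂ)) h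
  simpa [ev] using this

end Word

/-! ### The mixed state and the adapted factorization of the measurement. -/

section Mixture

variable {d : ℕ} (l : ℕ)

/-- The state `ρ` mixed with a little of the maximally mixed state. -/
def mixed (ρ : Matrix (Fin d) (Fin d) ℂ) : Matrix (Fin d) (Fin d) ℂ :=
  (1 - mixing l) • ρ + (mixing l / d) • 1

variable {l} {ρ : Matrix (Fin d) (Fin d) ℂ} (hl : 1 ≤ l)

include hl

lemma mixed_posSemidef (hρ : ρ.PosSemidef) : (mixed l ρ).PosSemidef :=
  (hρ.smul (by linarith [mixing_le hl] : (0 : ℝ) ≤ 1 - mixing l)).add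
    (PosSemidef.one.smul (div_nonneg (mixing_pos hl).le d.cast_nonneg))

lemma trace_mixed (hd : 1 ≤ d) (hρ : ρ.trace = 1) : (mixed l ρ).trace.re = 1 := by
  have hd0 : (d : ℝ) ≠ 0 := by exact_mod_cast (by omega : d ≠ 0)
  simp only [mixed, trace_add, trace_smul, hρ, trace_one, Fintype.card_fin]
  simp only [Complex.add_re, Complex.real_smul, Complex.re_ofReal_mul, Complex.one_re,
    Complex.natCast_re]
  field_simp
  ring

/-- The unitary freedom b ↦ bV in a_j = b bᴴ is spent on diagonalizing bᴴ ρ' b. Cuts of words are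
then diagonal, and for a state ρ the numbers s form a joint distribution of outcome and eigenvalue
index. -/
lemma exists_factorization {m : ℕ} {a : Fin m → Matrix (Fin d) (Fin d) ℂ} (ha : IsPOVM a)
    (hρ : ρ.PosSemidef) : ∃ (N : Fin m → Matrix (Fin d) (Fin d) ℂ) (s : Fin m → Fin d → ℝ),
      (∀ j, a j = N j * (N j)ᴴ) ∧
      ∀ j, (N j)ᴴ * mixed l ρ * N j = diagonal fun y => (s j y : ℂ) := by
  have key : ∀ j, ∃ (N : Matrix (Fin d) (Fin d) ℂ) (s : Fin d → ℝ), a j = N * Nᴴ ∧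
      Nᴴ * mixed l ρ * N = diagonal fun y => (s y : ℂ) := by
    intro j
    obtain ⟨b, hb⟩ := exists_self_mul_conjTranspose (ha.posSemidef j)
    have hp := (mixed_posSemidef hl hρ).conjTranspose_mul_mul_same b
    obtain ⟨V, hV, hV', hd⟩ := exists_diagonalization hp.1
    refine ⟨b * V, hp.1.eigenvalues, ?_, ?_⟩
    · rw [conjTranspose_mul, hb]
      calc b * bᴴ = b * (V * Vᴴ) * bᴴ := by rw [hV', mul_one]
        _ = _ := by simp only [mul_assoc]
    · rw [conjTranspose_mul]
      calc Vᴴ * bᴴ * mixed l ρ * (b * V) = Vᴴ * (bᴴ * mixed l ρ * b) * V := by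
            simp only [mul_assoc]
        _ = (Vᴴ * V) * diagonal (fun y => (hp.1.eigenvalues y : ℂ)) * (Vᴴ * V) := by
            conv_lhs => rw [hd]
            simp only [mul_assoc]
        _ = _ := by rw [hV, one_mul, mul_one]
  choose N s h1 h2 using key
  exact ⟨N, s, h1, h2⟩

/-- Nᴴ ρ' N mixes Nᴴ ρ N with Nᴴ N / d in the ratio 1-t to t. By concavity the loss is at most t
times the entropy of the first, as the second has trace at most 1 and thus nonnegative entropy. -/
lemma le_sum_negMulLog (hd : 1 ≤ d) {m : ℕ} {a N : Fin m → Matrix (Fin d) (Fin d) ℂ}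
    (ha : IsPOVM a) (hρ : ρ.PosSemidef) (hN : ∀ j, a j = N j * (N j)ᴴ) {s : Fin m → Fin d → ℝ}
    (hs : ∀ j, (N j)ᴴ * mixed l ρ * N j = diagonal fun y => (s j y : ℂ)) (j : Fin m) :
    entropy ((N j)ᴴ * ρ * N j) - mixing l * d ≤ ∑ y, Real.negMulLog (s j y) := by
  have hd0 : (0 : ℝ) < d := by exact_mod_cast hd
  have ht := mixing_pos hl
  have ht2 := mixing_le hl
  set t := mixing l with htdef
  have h1 : (∑ y, Real.negMulLog (s j y)) = entropy ((N j)ᴴ * mixed l ρ * N j) := by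
    rw [hs]
    have := entropy_conj_diagonal (U := (1 : Matrix (Fin d) (Fin d) ℂ)) (by simp) (s j)
    simpa using this.symm
  have hp := hρ.conjTranspose_mul_mul_same (N j)
  have hq : ((d : ℝ)⁻¹ • ((N j)ᴴ * N j)).PosSemidef :=
    (posSemidef_conjTranspose_mul_self (N j)).smul (inv_nonneg.2 hd0.le)
  have hq1 : ((d : ℝ)⁻¹ • ((N j)ᴴ * N j)).trace.re ≤ 1 := by
    rw [trace_smul, trace_mul_comm, ← hN, Complex.real_smul, Complex.re_ofReal_mul,
      inv_mul_le_iff₀ hd0, mul_one]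
    exact trace_povm_le ha j
  have h2 := sum_mul_entropy_le (ι := Fin 2) ![1 - t, t]
    (by intro i; fin_cases i; exacts [by simpa using (by linarith : t ≤ 1), by simpa using ht.le])
    (by simp) ![(N j)ᴴ * ρ * N j, (d : ℝ)⁻¹ • ((N j)ᴴ * N j)]
    (by intro i; fin_cases i; exacts [hp, hq])
  simp only [Fin.sum_univ_two, cons_val_zero, cons_val_one] at h2
  have e : (1 - t) • ((N j)ᴴ * ρ * N j) + t • (d : ℝ)⁻¹ • ((N j)ᴴ * N j)
      = (N j)ᴴ * mixed l ρ * N j := by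
    rw [mixed, ← htdef, mul_add, add_mul, mul_smul_comm, smul_mul_assoc, mul_smul_comm,
      smul_mul_assoc, mul_one, smul_smul, div_eq_mul_inv]
  rw [e] at h2
  rw [h1]
  have h3 := entropy_nonneg hq hq1
  have h4 := entropy_le_card hp
  rw [Fintype.card_fin] at h4
  nlinarith

end Mixture

/-! ### The typical projection and the conditionally typical cuts. -/

section TypicalOperators

variable {l d m : ℕ} (hl : 1 ≤ l) (hd : 1 ≤ d) (hm : 1 ≤ m)
  {ρ : Matrix (Fin d) (Fin d) ℂ} {a : Fin m → Matrix (Fin d) (Fin d) ℂ}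

/-- The constant governing the number of conditionally typical words. -/
def condConst (d m : ℕ) : ℝ := d + (m * d / 2 + 1 + m * √(2 * m)) + 2 * √(2 * m)

/-- The second moment of the conditional information density is at most this. -/
def condVar (d m : ℕ) : ℝ := 2 * (m * (4 + 4 * m)) + 8 * (m * d)

lemma sum_entropy_canonicalState_le (hρ : IsFaithfulState ρ) (ha : IsPOVM a) :
    ∑ j, outcomeProb ρ a j * entropy (canonicalState ρ a j) ≤ d := by
  have h1 := entropyDefect_nonneg hρ.posDef.posSemidef hρ.trace_eq_one ha
  have h2 := entropy_le_card hρ.posDef.posSemidef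
  rw [entropyDefect] at h1
  rw [Fintype.card_fin] at h2
  linarith

include hl hd

/-- The typical projection of a product state. It has large expectation in every state which is a
product of copies of `ρ` except at one position. -/
lemma exists_typicalProjection (hρ : IsFaithfulState ρ) {θ : ℝ} (hθ : 0 < θ) :
    ∃ P : Matrix (Fin l → Fin d) (Fin l → Fin d) ℂ, P.IsHermitian ∧ P * P = P ∧
      P ≤ Real.exp (l * entropy ρ + (θ + 2 * √(2 * d) + 1) * √(l : ℝ)) •
        tensor (fun _ => mixed l ρ) ∧
      ∀ (k : Fin l) (F : Matrix (Fin d) (Fin d) ℂ), F.PosSemidef → F.trace = 1 →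
        ev (tensor (Function.update (fun _ => ρ) k F)) (1 - P) ≤ (8 * d + 2) / θ ^ 2 := by
  obtain ⟨U, hU, hU', hdiag⟩ := exists_diagonalization hρ.posDef.1
  have hrpos : ∀ x, 0 < hρ.posDef.1.eigenvalues x := hρ.posDef.eigenvalues_pos
  have hH := entropy_eq_sum hρ.posDef.1
  have hr1 : ∑ x, hρ.posDef.1.eigenvalues x = 1 := by
    have h := hρ.posDef.1.trace_eq_sum_eigenvalues
    rw [hρ.trace_eq_one] at h
    have := congrArg Complex.re h
    simpa using this.symm
  generalize hρ.posDef.1.eigenvalues = r at hdiag hrpos hH hr1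
  set Λ : ℝ := l * entropy ρ + (θ + 2 * √(2 * d) + 1) * √(l : ℝ) with hΛ
  let r' : Fin d → ℝ := fun x => (1 - mixing l) * r x + mixing l / d
  have hmix : mixed l ρ = U * diagonal (fun x => (r' x : ℂ)) * Uᴴ := by
    have h1 : (1 : Matrix (Fin d) (Fin d) ℂ) = U * 1 * Uᴴ := by rw [mul_one, hU']
    have h2 : diagonal (fun x => (r' x : ℂ)) = (1 - mixing l) • diagonal (fun x => (r x : ℂ))
        + (mixing l / d) • (1 : Matrix (Fin d) (Fin d) ℂ) := by
      rw [smul_one_eq_diagonal, ← diagonal_smul, diagonal_add]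
      congr 1
      ext x
      simp [r']
    rw [mixed, h2, mul_add, add_mul, mul_smul_comm, smul_mul_assoc, ← hdiag, mul_smul_comm,
      smul_mul_assoc, ← h1]
  -- A one-sided cut: only the small eigenvalues of ρ'^{⊗l} are discarded, which is all that the
  -- bound of P by a multiple of ρ'^{⊗l} requires.
  let f : (Fin l → Fin d) → ℝ := fun x => if Real.exp (-Λ) ≤ ∏ i, r' (x i) then 1 else 0
  set UU := tensor (fun _ : Fin l => U) with hUU
  have hUUh : UUᴴ = tensor (fun _ : Fin l => Uᴴ) := tensor_conjTranspose _
  have hU1 : UUᴴ * UU = 1 := by rw [hUUh, hUU, tensor_mul]; simp only [hU]; exact tensor_one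
  have hU2 : UU * UUᴴ = 1 := by rw [hUUh, hUU, tensor_mul]; simp only [hU']; exact tensor_one
  have hR : tensor (fun _ : Fin l => mixed l ρ)
      = UU * diagonal (fun x => ((∏ i, r' (x i) : ℝ) : ℂ)) * UUᴴ := by
    have h := tensor_diagonal (l := l) (fun _ x => (r' x : ℂ))
    simp only [Complex.ofReal_prod]
    rw [← h, hUUh, hUU, tensor_mul, tensor_mul]
    simp only [hmix]
  have hff : ∀ x, f x * f x = f x := fun x => by
    simp only [f]; split_ifs <;> simp
  refine ⟨UU * diagonal (fun x => (f x : ℂ)) * UUᴴ, isHermitian_conj_diagonal _ _, ?_, ?_, ?_⟩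
  · rw [conj_diagonal_mul hU1]
    simp only [← Complex.ofReal_mul, hff]
  · have e : Real.exp Λ • tensor (fun _ : Fin l => mixed l ρ)
        = UU * diagonal (fun x => ((Real.exp Λ * ∏ i, r' (x i) : ℝ) : ℂ)) * UUᴴ := by
      rw [hR, ← smul_mul_assoc, ← mul_smul_comm, ← diagonal_smul]
      congr 3
      ext x
      simp
    rw [e]
    refine conj_diagonal_le fun x => ?_
    simp only [f]
    split_ifs with h
    · calc (1 : ℝ) = Real.exp Λ * Real.exp (-Λ) := by rw [← Real.exp_add]; simp
        _ ≤ _ := mul_le_mul_of_nonneg_left h (Real.exp_pos _).le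
    · have ht := mixing_pos hl
      have ht2 := mixing_le hl
      refine mul_nonneg (Real.exp_pos _).le (Finset.prod_nonneg fun i _ => ?_)
      have := (hrpos (x i)).le
      exact add_nonneg (mul_nonneg (by linarith) this) (by positivity)
  · intro k F hF hF1
    have e1 : (1 : Matrix (Fin l → Fin d) (Fin l → Fin d) ℂ)
        - UU * diagonal (fun x => (f x : ℂ)) * UUᴴ
        = UU * diagonal (fun x => ((1 - f x : ℝ) : ℂ)) * UUᴴ := by
      have h1 : (1 : Matrix (Fin l → Fin d) (Fin l → Fin d) ℂ) = UU * 1 * UUᴴ := by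
        rw [mul_one, hU2]
      conv_lhs => rw [h1]
      rw [← sub_mul, ← mul_sub, ← diagonal_one, diagonal_sub]
      simp
    rw [e1, hUU, ev_tensor_conj_diagonal (update_posSemidef hρ.posDef.posSemidef hF k)]
    have hUrU : Uᴴ * ρ * U = diagonal (fun x => (r x : ℂ)) := by
      rw [hdiag]
      calc _ = (Uᴴ * U) * diagonal (fun x => (r x : ℂ)) * (Uᴴ * U) := by simp only [mul_assoc]
        _ = _ := by rw [hU, one_mul, mul_one]
    let g : Fin d → ℝ := fun x => ((Uᴴ * F * U) x x).re
    have hfac : ∀ (x : Fin l → Fin d) (i : Fin l),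
        ((Uᴴ * Function.update (fun _ : Fin l => ρ) k F i * U) (x i) (x i)).re
          = (if i = k then g else r) (x i) := by
      intro x i
      by_cases h : i = k
      · subst h; simp [g]
      · simp [h, hUrU]
    simp only [hfac]
    have hg1 : ∑ x, g x = 1 := by
      simp only [g]
      rw [← Complex.re_sum]
      change (Uᴴ * F * U).trace.re = 1
      rw [trace_mul_cycle, hU', one_mul, hF1, Complex.one_re]
    have key := sum_atypical_le hl hd r g hrpos hr1
      (fun x => diag_re_nonneg (hF.conjTranspose_mul_mul_same U) x) hg1 k hθ
      (Finset.univ.filter fun x => ¬ Real.exp (-Λ) ≤ ∏ i, r' (x i))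
      (by
        intro x hx
        rw [← hH]
        exact not_le.1 (Finset.mem_filter.1 hx).2)
    refine le_trans (le_of_eq ?_) key
    rw [Finset.sum_filter]
    refine Finset.sum_congr rfl fun x _ => ?_
    simp only [f]
    split_ifs <;> simp_all

include hm

/-- Conditionally typical cuts of a factorization of the measurement. -/
lemma sum_conditional_tail_le (hρ : IsFaithfulState ρ) (ha : IsPOVM a)
    {N : Fin m → Matrix (Fin d) (Fin d) ℂ} {s : Fin m → Fin d → ℝ}
    (hN : ∀ j, a j = N j * (N j)ᴴ)
    (hs : ∀ j, (N j)ᴴ * mixed l ρ * N j = diagonal fun y => (s j y : ℂ))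
    {θ : ℝ} (hθ : 0 < θ) (k : Fin l) {F : Matrix (Fin d) (Fin d) ℂ} (hF : F.PosSemidef)
    (hF1 : F.trace = 1) :
    ∑ J : Fin l → Fin m, ev (tensor (Function.update (fun _ => ρ) k F))
      (tensor (fun i => N (J i)) * diagonal (fun y => ((if ∏ i, s (J i) (y i) ≤
        (∏ i, ((1 - mixing l) * outcomeProb ρ a (J i) + mixing l / m)) * Real.exp
          (-(l * ∑ j, outcomeProb ρ a j * entropy (canonicalState ρ a j))
            + (θ + condConst d m) * √(l : ℝ)) then 0 else 1 : ℝ) : ℂ)) *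
        (tensor (fun i => N (J i)))ᴴ) ≤ 2 * (condVar d m / θ ^ 2) := by
  have hρp := hρ.posDef.posSemidef
  have hl0 : (0 : ℝ) < l := by exact_mod_cast hl
  have hd0 : (0 : ℝ) < d := by exact_mod_cast hd
  have hm0 : (0 : ℝ) < m := by exact_mod_cast hm
  have ht := mixing_pos hl
  have ht2 := mixing_le hl
  have hlt := natCast_mul_mixing hl
  have hsq := one_le_sqrt_natCast hl
  have hlog := log_div_mixing_le hl hm
  have hmp := mixed_posSemidef hl hρp
  have hlam := outcomeProb_nonneg hρp ha
  have hlam1 := sum_outcomeProb hρ.trace_eq_one ha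
  have hhd := sum_entropy_canonicalState_le hρ ha
  have hh : ∑ j, outcomeProb ρ a j * entropy (canonicalState ρ a j)
      = ∑ j, entropy ((N j)ᴴ * ρ * N j) - ∑ j, Real.negMulLog (outcomeProb ρ a j) := by
    rw [← Finset.sum_sub_distrib]
    exact Finset.sum_congr rfl fun j _ => outcomeProb_mul_entropy hρp ha hN j
  have hsval : ∀ j y, s j y = (((N j)ᴴ * mixed l ρ * N j) y y).re := by
    intro j y; rw [hs]; simp
  have hsnn : ∀ j y, 0 ≤ s j y := fun j y => by
    rw [hsval]; exact diag_re_nonneg (hmp.conjTranspose_mul_mul_same _) y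
  have hs1 : ∑ c : Fin m × Fin d, s c.1 c.2 = 1 := by
    simp only [hsval]
    rw [sum_diag_conj_povm ha hN, trace_mixed hl hd hρ.trace_eq_one]
  have hsle : ∀ c : Fin m × Fin d, s c.1 c.2 ≤ 1 := fun c => by
    rw [← hs1]
    exact Finset.single_le_sum (f := fun c : Fin m × Fin d => s c.1 c.2)
      (fun c _ => hsnn c.1 c.2) (Finset.mem_univ c)
  have hL : ∀ j, ∑ y, s j y ≤ (1 - mixing l) * outcomeProb ρ a j + mixing l := by
    intro j
    simp only [hsval]
    rw [sum_diag_conj hN, ev_comm, mixed, ev_add, ev_smul, ev_smul, ev_comm, ev_one,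
      outcomeProb_eq_ev]
    have h1 := trace_povm_le ha j
    have h2 : mixing l / d * (a j).trace.re ≤ mixing l := by
      rw [div_mul_eq_mul_div, div_le_iff₀ hd0]
      exact mul_le_mul_of_nonneg_left h1 ht.le
    linarith
  set h := ∑ j, outcomeProb ρ a j * entropy (canonicalState ρ a j) with hdef
  have hent : ∑ j, entropy ((N j)ᴴ * ρ * N j) - m * (mixing l * d)
      ≤ ∑ c : Fin m × Fin d, Real.negMulLog (s c.1 c.2) := by
    rw [Fintype.sum_prod_type]
    have := Finset.sum_le_sum fun j (_ : j ∈ Finset.univ) => le_sum_negMulLog hl hd ha hρp hN hs j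
    simpa [Finset.sum_sub_distrib] using this
  have hmean := sum_mul_log_ge hl hm (outcomeProb ρ a) hlam hlam1 (fun c => s c.1 c.2) hL
  have hvar := sum_mul_log_sq_le hl hm (outcomeProb ρ a) hlam hlam1 (fun c => s c.1 c.2)
    (fun c => hsnn c.1 c.2) hsle hL
  -- By l t = 1/2 the errors of order t contribute md/2 and 1, and the logarithmic one m/2 · log
  -- (m/t) ≤ m √(2m) √l.
  have hE : l * h - (m * d / 2 + 1 + m * √(2 * m)) * √(l : ℝ)
      ≤ l * ∑ c : Fin m × Fin d, s c.1 c.2 *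
        (Real.log ((1 - mixing l) * outcomeProb ρ a c.1 + mixing l / m)
          - Real.log (s c.1 c.2)) := by
    have h1 := mul_le_mul_of_nonneg_left hmean hl0.le
    refine le_trans ?_ h1
    have h2 := mul_le_mul_of_nonneg_left hent hl0.le
    have h3 : (l : ℝ) * (m * (mixing l * d)) = m * d / 2 := by
      calc (l : ℝ) * (m * (mixing l * d)) = (l * mixing l) * (m * d) := by ring
        _ = _ := by rw [hlt]; ring
    have h4 : (l : ℝ) * (m * (mixing l * Real.log (m / mixing l)))
        = m / 2 * Real.log (m / mixing l) := by
      calc (l : ℝ) * (m * (mixing l * Real.log (m / mixing l)))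
          = (l * mixing l) * (m * Real.log (m / mixing l)) := by ring
        _ = _ := by rw [hlt]; ring
    have h5 := mul_le_mul_of_nonneg_left hlog (by positivity : (0 : ℝ) ≤ m / 2)
    have h6 : (m * d / 2 + 1 : ℝ) ≤ (m * d / 2 + 1) * √(l : ℝ) :=
      le_mul_of_one_le_right (by positivity) hsq
    rw [hh]
    nlinarith
  have key := sum_conditionally_atypical_le hl hm (fun c : Fin m × Fin d => s c.1 c.2)
    (fun c => (((N c.1)ᴴ * ρ * N c.1) c.2 c.2).re)
    (fun c => (((N c.1)ᴴ * F * N c.1) c.2 c.2).re)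
    (fun c => (1 - mixing l) * outcomeProb ρ a c.1 + mixing l / m)
    (fun c => hsnn c.1 c.2) hs1
    (fun c => diag_re_nonneg (hF.conjTranspose_mul_mul_same _) _)
    (by rw [sum_diag_conj_povm ha hN, hF1, Complex.one_re])
    (fun c => diag_re_nonneg (hρp.conjTranspose_mul_mul_same _) _)
    (by
      intro c
      rw [hsval, mixed, mul_add, add_mul, mul_smul_comm, smul_mul_assoc, mul_smul_comm,
        smul_mul_assoc, mul_one]
      have h1 := diag_re_nonneg (posSemidef_conjTranspose_mul_self (N c.1)) c.2
      have h2 : (0 : ℝ) ≤ mixing l / d := by positivity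
      simp only [Matrix.add_apply, Matrix.smul_apply, Complex.add_re, Complex.real_smul,
        Complex.re_ofReal_mul]
      nlinarith)
    (by
      intro c
      have := hlam c.1
      nlinarith)
    (h := h) (D := d) (V := condVar d m) hhd hd0.le hE (by positivity) hvar k hθ
    (Finset.univ.filter fun c : Fin l → Fin m × Fin d => ¬ ∏ i, s (c i).1 (c i).2 ≤
        (∏ i, ((1 - mixing l) * outcomeProb ρ a (c i).1 + mixing l / m)) * Real.exp
          (-(l * h) + (θ + condConst d m) * √(l : ℝ)))
    (by
      intro c hc
      have h1 := not_le.1 (Finset.mem_filter.1 hc).2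
      have e : θ + condConst d m
        = θ + d + (m * d / 2 + 1 + m * √(2 * m)) + 2 * √(2 * m) := by
        rw [condConst]; ring
      rw [e] at h1
      exact h1)
  refine le_trans (le_of_eq ?_) key
  rw [Finset.sum_filter, ← Equiv.sum_comp (Equiv.arrowProdEquivProdArrow (Fin l)
    (fun _ => Fin m) (fun _ => Fin d)).symm, Fintype.sum_prod_type]
  refine Finset.sum_congr rfl fun J _ => ?_
  rw [ev_tensor_conj_diagonal (update_posSemidef hρp hF k)]
  refine Finset.sum_congr rfl fun y _ => ?_
  have hp : ∏ i, (((N (J i))ᴴ * Function.update (fun _ : Fin l => ρ) k F i * N (J i))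
      (y i) (y i)).re = ∏ i, (if i = k then
        (fun c : Fin m × Fin d => (((N c.1)ᴴ * F * N c.1) c.2 c.2).re)
          else fun c => (((N c.1)ᴴ * ρ * N c.1) c.2 c.2).re) (J i, y i) :=
    Finset.prod_congr rfl fun i _ => re_conj_update_apply ρ F k i N (J i, y i)
  rw [hp]
  split_ifs with h1 h2 h2 <;>
    first | exact zero_mul _ | exact one_mul _ | exact absurd h1 h2 | exact absurd h2 h1

end TypicalOperators

/-! ### The typical part of the product measurement. -/

section Resolution

lemma self_mul_conjTranspose_sub {n : Type} [Fintype n] [DecidableEq n] (N : Matrix n n ℂ)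
    (f : n → ℝ) : N * Nᴴ - N * diagonal (fun y => (f y : ℂ)) * Nᴴ
      = N * diagonal (fun y => ((1 - f y : ℝ) : ℂ)) * Nᴴ := by
  have h : diagonal (fun y => ((1 - f y : ℝ) : ℂ)) = 1 - diagonal (fun y => (f y : ℂ)) := by
    rw [← diagonal_one, diagonal_sub]
    simp
  rw [h, mul_sub, sub_mul, mul_one]

variable {l d m : ℕ} (hl : 1 ≤ l) (hd : 1 ≤ d) (hm : 1 ≤ m)
  {ρ : Matrix (Fin d) (Fin d) ℂ} {a : Fin m → Matrix (Fin d) (Fin d) ℂ}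

/-- The coefficient of `√l` in the exponent of the operators of the typical resolution. -/
def typicalConst (d m : ℕ) (θ : ℝ) : ℝ := (θ + 2 * √(2 * d) + 1) + (θ + condConst d m)

/-- The error of the marginals of the typical resolution. -/
def typicalError (d m : ℕ) (θ : ℝ) : ℝ :=
  2 * √((8 * d + 2) / θ ^ 2) + 2 * (condVar d m / θ ^ 2)

include hl hd hm

/-- The typical part of the product measurement: a resolution into operators of norm at most
`exp (l (entropy defect) + O(√l))` whose marginals approximate the given measurement. -/
lemma exists_typicalResolution (hρ : IsFaithfulState ρ) (ha : IsPOVM a) {θ : ℝ} (hθ : 0 < θ) :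
    ∃ (p : (Fin l → Fin m) → ℝ)
      (X : (Fin l → Fin m) → Matrix (Fin l → Fin d) (Fin l → Fin d) ℂ),
      (∀ J, 0 ≤ p J) ∧ ∑ J, p J = 1 ∧ (∀ J, (X J).PosSemidef) ∧
      (∀ J, X J * X J ≤
        Real.exp (l * entropyDefect ρ a + typicalConst d m θ * √(l : ℝ)) • X J) ∧
      ∑ J, p J • X J ≤ 1 ∧
      ∀ (k : Fin l) (j : Fin m) (F : Matrix (Fin d) (Fin d) ℂ), F.PosSemidef → F.trace = 1 →
        |ev (tensor (Function.update (fun _ => ρ) k F))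
            (∑ J, p J • (if J k = j then 1 else 0 : ℝ) • X J) - ev F (a j)|
          ≤ typicalError d m θ := by
  have hρp := hρ.posDef.posSemidef
  have hm0 : (0 : ℝ) < m := by exact_mod_cast hm
  have ht := mixing_pos hl
  have ht2 := mixing_le hl
  obtain ⟨P, hP, hPP, hPR, hPtail⟩ := exists_typicalProjection hl hd hρ hθ
  obtain ⟨N, s, hN, hs⟩ := exists_factorization hl ha hρp
  have htail := fun k (F : Matrix (Fin d) (Fin d) ℂ) (hF : F.PosSemidef) (hF1 : F.trace = 1) =>
    sum_conditional_tail_le hl hd hm hρ ha hN hs hθ k hF hF1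
  -- Mixing in the uniform distribution makes every word probability positive, so that division by
  -- p(J) is harmless even if some λ_j vanishes.
  set pr : Fin m → ℝ := fun j => (1 - mixing l) * outcomeProb ρ a j + mixing l / m with hpr
  have hprpos : ∀ j, 0 < pr j := fun j => by
    have h1 := outcomeProb_nonneg hρp ha j
    have h2 : 0 < mixing l / m := by positivity
    simp only [hpr]; nlinarith
  have hpr1 : ∑ j, pr j = 1 := by
    simp only [hpr]
    rw [Finset.sum_add_distrib, ← Finset.mul_sum, sum_outcomeProb hρ.trace_eq_one ha]
    simp
    field_simp
    ring
  set h := ∑ j, outcomeProb ρ a j * entropy (canonicalState ρ a j) with hh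
  set Λ := -(l * h) + (θ + condConst d m) * √(l : ℝ) with hΛ
  let p : (Fin l → Fin m) → ℝ := fun J => ∏ i, pr (J i)
  have hppos : ∀ J, 0 < p J := fun J => Finset.prod_pos fun i _ => hprpos _
  have hp1 : ∑ J, p J = 1 := by
    simp only [p]
    rw [sum_pi_prod (fun _ : Fin l => pr)]
    simp [hpr1]
  let f : (Fin l → Fin m) → (Fin l → Fin d) → ℝ := fun J y =>
    if ∏ i, s (J i) (y i) ≤ p J * Real.exp Λ then 1 else 0
  have hf0 : ∀ J y, 0 ≤ f J y := fun J y => by simp only [f]; split_ifs <;> norm_num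
  have hf1 : ∀ J y, f J y ≤ 1 := fun J y => by simp only [f]; split_ifs <;> norm_num
  have hff : ∀ J y, f J y * f J y = f J y := fun J y => by simp only [f]; split_ifs <;> norm_num
  let NN : (Fin l → Fin m) → Matrix (Fin l → Fin d) (Fin l → Fin d) ℂ := fun J =>
    tensor fun i => N (J i)
  have hNN : ∀ J, NN J * (NN J)ᴴ = tensor fun i => a (J i) := by
    intro J
    simp only [NN]
    rw [tensor_conjTranspose, tensor_mul]
    simp only [hN]
  let Y : (Fin l → Fin m) → Matrix (Fin l → Fin d) (Fin l → Fin d) ℂ := fun J =>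
    NN J * diagonal (fun y => (f J y : ℂ)) * (NN J)ᴴ
  have hY : ∀ J, (Y J).PosSemidef := fun J => conj_diagonal_posSemidef _ (hf0 J)
  have hYle : ∀ J, Y J ≤ tensor fun i => a (J i) := by
    intro J
    have h1 := conj_diagonal_le (U := NN J) (hf1 J)
    have h2 : NN J * diagonal (fun _ => ((1 : ℝ) : ℂ)) * (NN J)ᴴ = tensor fun i => a (J i) := by
      rw [← hNN]; simp
    rwa [h2] at h1
  have htot : ∑ J : Fin l → Fin m, tensor (fun i => a (J i)) = 1 := by
    rw [sum_tensor (fun _ : Fin l => a)]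
    simp only [ha.sum_eq_one]
    exact tensor_one
  have hapsd : ∀ J : Fin l → Fin m, (tensor fun i => a (J i)).PosSemidef := fun J =>
    tensor_posSemidef fun i => ha.posSemidef _
  have hPYP : ∀ {Z : Matrix (Fin l → Fin d) (Fin l → Fin d) ℂ}, Z.PosSemidef →
      (P * Z * P).PosSemidef := by
    intro Z hZ
    have := hZ.mul_mul_conjTranspose_same P
    rwa [hP.eq] at this
  have hPsum : ∀ c : (Fin l → Fin m) → ℝ,
      ∑ J, p J • c J • ((p J)⁻¹ • (P * Y J * P)) = P * (∑ J, c J • Y J) * P := by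
    intro c
    rw [Matrix.mul_sum, Matrix.sum_mul]
    refine Finset.sum_congr rfl fun J _ => ?_
    rw [mul_smul_comm, smul_mul_assoc, smul_comm (c J), smul_smul, mul_inv_cancel₀ (hppos J).ne',
      one_smul]
  have hP1 : P ≤ 1 := by
    rw [le_iff]
    have h2 := posSemidef_mul_self ((isHermitian_one (n := Fin l → Fin d) (α := ℂ)).sub hP)
    have e : (1 - P) * (1 - P) = 1 - P := by
      simp [mul_sub, sub_mul, hPP]
    rwa [e] at h2
  refine ⟨p, fun J => (p J)⁻¹ • (P * Y J * P), fun J => (hppos J).le, hp1, ?_, ?_, ?_, ?_⟩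
  · exact fun J => (hPYP (hY J)).smul (inv_nonneg.2 (hppos J).le)
  · intro J
    have hNR : (NN J)ᴴ * tensor (fun _ => mixed l ρ) * NN J
        = diagonal fun y => ((∏ i, s (J i) (y i) : ℝ) : ℂ) := by
      have h1 := tensor_diagonal (fun i y => (s (J i) y : ℂ))
      simp only [Complex.ofReal_prod]
      rw [← h1]
      simp only [NN]
      rw [tensor_conjTranspose, tensor_mul, tensor_mul]
      simp only [hs]
    have key := cut_mul_self_le (c := (p J)⁻¹) hP hPP (Real.exp_pos _).le hPR hNR (hff J)
      (e₂ := p J * Real.exp Λ) (by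
        intro y
        simp only [f]
        split_ifs with hy
        · rwa [one_mul]
        · rw [zero_mul]; exact mul_nonneg (hppos J).le (Real.exp_pos _).le)
    refine key.trans_eq ?_
    rw [smul_smul]
    congr 1
    have hexp : Real.exp (l * entropyDefect ρ a + typicalConst d m θ * √(l : ℝ))
        = Real.exp (l * entropy ρ + (θ + 2 * √(2 * d) + 1) * √(l : ℝ)) * Real.exp Λ := by
      rw [← Real.exp_add]
      congr 1
      rw [hΛ, typicalConst, entropyDefect, ← hh]
      ring
    rw [hexp]
    have := (hppos J).ne'
    field_simp
  · have h1 := hPsum fun _ => 1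
    simp only [one_smul] at h1
    rw [h1]
    have h2 : ∑ J, Y J ≤ 1 := by
      rw [← htot]; exact Finset.sum_le_sum fun J _ => hYle J
    have h3 := conj_mono h2 P
    rw [hP.eq, mul_one, hPP] at h3
    exact h3.trans hP1
  · intro k j F hF hF1
    rw [hPsum]
    set σ := tensor (Function.update (fun _ => ρ) k F) with hσdef
    have hσ : σ.PosSemidef := tensor_posSemidef (update_posSemidef hρp hF k)
    have hσ1 : σ.trace = 1 := by rw [hσdef, trace_tensor_update hρ.trace_eq_one, hF1]
    set Z := ∑ J, (if J k = j then 1 else 0 : ℝ) • Y J with hZ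
    have hZpsd : Z.PosSemidef := posSemidef_sum _ fun J _ => (hY J).smul (by
      split_ifs <;> norm_num)
    have hZle : Z ≤ 1 := by
      rw [← htot]
      refine Finset.sum_le_sum fun J _ => ?_
      split_ifs
      · rw [one_smul]; exact hYle J
      · rw [zero_smul]; exact (hapsd J).nonneg
    have h1 := abs_ev_projection_sub_le hσ hσ1 hP hPP hZpsd hZle (hPtail k F hF hF1)
    have h2 : ev F (a j) = ev σ (∑ J : Fin l → Fin m with J k = j, tensor fun i => a (J i)) := by
      rw [sum_tensor_of_apply_eq, ha.sum_eq_one, hσdef, ev_tensor_update_update hρ.trace_eq_one]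
    have hZ' : Z = ∑ J : Fin l → Fin m with J k = j, Y J := by
      rw [hZ, Finset.sum_filter]
      refine Finset.sum_congr rfl fun J _ => ?_
      split_ifs <;> simp
    -- The error is the discarded part of the product measurement; its terms are nonnegative, so the
    -- sum may be extended from the words with J k = j to all words.
    have h3 : |ev σ Z - ev F (a j)| ≤ 2 * (condVar d m / θ ^ 2) := by
      rw [h2, hZ', abs_sub_comm, ← ev_sub, ← Finset.sum_sub_distrib, abs_of_nonneg, ev_sum]
      · refine le_trans ?_ (htail k F hF hF1)
        refine le_trans (Finset.sum_le_sum_of_subset_of_nonneg (Finset.filter_subset _ _)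
          fun J _ _ => ev_nonneg hσ (le_iff.1 (hYle J))) (le_of_eq ?_)
        refine Finset.sum_congr rfl fun J _ => ?_
        have e : ∀ y, (if ∏ i, s (J i) (y i) ≤ p J * Real.exp Λ then 0 else 1 : ℝ)
            = 1 - f J y := fun y => by
          simp only [f]; split_ifs <;> norm_num
        have e2 : NN J * diagonal (fun y => ((if ∏ i, s (J i) (y i) ≤ p J * Real.exp Λ
            then 0 else 1 : ℝ) : ℂ)) * (NN J)ᴴ = tensor (fun i => a (J i)) - Y J := by
          simp only [e]
          rw [← hNN, self_mul_conjTranspose_sub]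
        exact congrArg (ev σ) e2.symm
      · exact ev_nonneg hσ (posSemidef_sum _ fun J _ => le_iff.1 (hYle J))
    have h4 := abs_sub_le (ev σ (P * Z * P)) (ev σ Z) (ev F (a j))
    rw [typicalError]
    linarith

end Resolution

/-! ### From expectation values to marginals of a completed measurement. -/

section Marginals

variable {l d m M : ℕ} {ρ : Matrix (Fin d) (Fin d) ℂ}

lemma trace_mul_im_eq_zero {n : Type} [Fintype n] {ω A : Matrix n n ℂ} (hω : ω.PosSemidef)
    (hA : A.PosSemidef) : (ω * A).trace.im = 0 := by
  obtain ⟨B, rfl⟩ := exists_conjTranspose_mul_self hω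
  rw [mul_assoc, trace_mul_comm]
  exact (Complex.le_def.1 (hA.mul_mul_conjTranspose_same B).trace_nonneg).2.symm

lemma dotProduct_eq_trace {n : Type} [Fintype n] (v : n → ℂ) (A : Matrix n n ℂ) :
    star v ⬝ᵥ A *ᵥ v = (vecMulVec v (star v) * A).trace := by
  rw [trace_mul_comm, mul_vecMulVec, trace_vecMulVec, dotProduct_comm]

/-- For a projection Q, 1 - Q = (1 - Q)² ≥ 0. Consequently a single weight with 1 at position k
dominates the product states of all unit vectors v. -/
lemma vecMulVec_le_one {n : Type} [Fintype n] [DecidableEq n] {v : n → ℂ}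
    (hv : star v ⬝ᵥ v = 1) : vecMulVec v (star v) ≤ 1 := by
  rw [le_iff]
  have hh : (vecMulVec v (star v)).IsHermitian := (posSemidef_vecMulVec_self_star v).1
  have h2 := posSemidef_mul_self ((isHermitian_one (n := n) (α := ℂ)).sub hh)
  have e : (1 - vecMulVec v (star v)) * (1 - vecMulVec v (star v))
      = 1 - vecMulVec v (star v) := by
    have : vecMulVec v (star v) * vecMulVec v (star v) = vecMulVec v (star v) := by
      rw [vecMulVec_mul_vecMulVec, hv, one_smul]
    simp [mul_sub, sub_mul, this]
  rwa [e] at h2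

/-- A bound for the marginals from bounds for expectation values. -/
lemma opNorm_marginal_sub_le (hρ : ρ.PosSemidef)
    {A : Fin M → Matrix (Fin l → Fin d) (Fin l → Fin d) ℂ} (hA : ∀ μ, (A μ).PosSemidef)
    (w : Fin M → Fin l → Fin m) (k : Fin l) (j : Fin m) {b : Matrix (Fin d) (Fin d) ℂ}
    (hb : b.PosSemidef) {δ : ℝ} (hδ : 0 ≤ δ)
    (h : ∀ v : Fin d → ℂ, star v ⬝ᵥ v = 1 →
      |ev (tensor (Function.update (fun _ => ρ) k (vecMulVec v (star v))))
        (∑ μ with w μ k = j, A μ) - ev (vecMulVec v (star v)) b| ≤ δ) :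
    opNorm (marginal ρ A w k j - b) ≤ δ := by
  have hq : ∀ v : Fin d → ℂ, star v ⬝ᵥ (marginal ρ A w k j - b) *ᵥ v
      = (tensor (Function.update (fun _ => ρ) k (vecMulVec v (star v))) *
          ∑ μ with w μ k = j, A μ).trace - (vecMulVec v (star v) * b).trace := by
    intro v
    rw [sub_mulVec, dotProduct_sub, marginal, dotProduct_partialTraceExcept, dotProduct_eq_trace]
  refine opNorm_le_of_hermitian (isHermitian_of_dotProduct_real fun v => ?_) hδ fun v hv => ?_
  · rw [hq, Complex.sub_im, trace_mul_im_eq_zero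
      (tensor_posSemidef (update_posSemidef hρ (posSemidef_vecMulVec_self_star v) k))
      (posSemidef_sum _ fun μ _ => hA μ),
      trace_mul_im_eq_zero (posSemidef_vecMulVec_self_star v) hb, sub_zero]
  · rw [hq, Complex.sub_re]
    exact h v hv

/-- Completing a subnormalized measurement by one outcome. -/
lemma exists_completed (hρ : IsFaithfulState ρ) {a : Fin m → Matrix (Fin d) (Fin d) ℂ}
    (ha : IsPOVM a) (hm : 1 ≤ m) {A : Fin M → Matrix (Fin l → Fin d) (Fin l → Fin d) ℂ}
    (hA : ∀ μ, (A μ).PosSemidef) (hA1 : ∑ μ, A μ ≤ 1) (w : Fin M → Fin l → Fin m) {η : ℝ}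
    (hη : 0 ≤ η)
    (h : ∀ (k : Fin l) (j : Fin m) (v : Fin d → ℂ), star v ⬝ᵥ v = 1 →
      |ev (tensor (Function.update (fun _ => ρ) k (vecMulVec v (star v))))
        (∑ μ, (if w μ k = j then 1 else 0 : ℝ) • A μ) - ev (vecMulVec v (star v)) (a j)| ≤ η) :
    ∃ (A' : Fin (M + 1) → Matrix (Fin l → Fin d) (Fin l → Fin d) ℂ)
      (w' : Fin (M + 1) → Fin l → Fin m), IsPOVM A' ∧
      ∀ k : Fin l, ∑ j, opNorm (marginal ρ A' w' k j - a j) ≤ 2 * m * η := by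
  let j₀ : Fin m := ⟨0, hm⟩
  let A' : Fin (M + 1) → Matrix (Fin l → Fin d) (Fin l → Fin d) ℂ := Fin.snoc A (1 - ∑ μ, A μ)
  let w' : Fin (M + 1) → Fin l → Fin m := Fin.snoc w fun _ => j₀
  have hA' : ∀ μ, (A' μ).PosSemidef := by
    intro μ
    refine Fin.lastCases ?_ (fun i => ?_) μ
    · simp only [A', Fin.snoc_last]; exact le_iff.1 hA1
    · simp only [A', Fin.snoc_castSucc]; exact hA i
  refine ⟨A', w', ⟨hA', ?_⟩, fun k => ?_⟩
  · rw [Fin.sum_univ_castSucc]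
    simp [A']
  have hsum : ∀ j, ∑ μ with w' μ k = j, A' μ
      = ∑ μ, (if w μ k = j then 1 else 0 : ℝ) • A μ
        + (if j₀ = j then 1 else 0 : ℝ) • (1 - ∑ μ, A μ) := by
    intro j
    rw [Finset.sum_filter, Fin.sum_univ_castSucc]
    simp only [A', w', Fin.snoc_castSucc, Fin.snoc_last, ite_smul, one_smul, zero_smul]
  have hnorm : ∀ j, opNorm (marginal ρ A' w' k j - a j) ≤ η + if j₀ = j then m * η else 0 := by
    intro j
    refine opNorm_marginal_sub_le hρ.posDef.posSemidef hA' w' k j (ha.posSemidef j) ?_ ?_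
    · split_ifs <;> positivity
    · intro v hv
      set σ := tensor (Function.update (fun _ => ρ) k (vecMulVec v (star v))) with hσ
      have hF1 : (vecMulVec v (star v)).trace = 1 := by
        rw [trace_vecMulVec, dotProduct_comm, hv]
      -- Both 1 and ∑ A decompose over j, so the missing mass is at most the sum of the m errors η.
      -- The added outcome is charged to the letter j₀ at every position, whence the total 2mη.
      have hR : |ev σ (1 - ∑ μ, A μ)| ≤ m * η := by
        have e1 : ∑ μ, A μ = ∑ j, ∑ μ, (if w μ k = j then 1 else 0 : ℝ) • A μ := by
          rw [Finset.sum_comm]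
          refine Finset.sum_congr rfl fun μ _ => ?_
          rw [← Finset.sum_smul]
          simp
        have e2 : ev σ 1 = ∑ j, ev (vecMulVec v (star v)) (a j) := by
          rw [← ev_sum, ha.sum_eq_one, ev_one, ev_one, hF1, hσ,
            trace_tensor_update hρ.trace_eq_one, hF1]
        rw [ev_sub, e2, e1, ev_sum, ← Finset.sum_sub_distrib]
        refine (Finset.abs_sum_le_sum_abs _ _).trans ?_
        calc _ ≤ ∑ _j : Fin m, η := Finset.sum_le_sum fun j _ => by
              rw [abs_sub_comm]; exact h k j v hv
          _ = m * η := by simp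
      rw [hsum, ev_add, ev_smul, add_sub_right_comm]
      refine (abs_add_le _ _).trans (add_le_add (h k j v hv) ?_)
      split_ifs
      · rwa [one_mul]
      · simp
  calc _ ≤ ∑ j, (η + if j₀ = j then m * η else 0) := Finset.sum_le_sum fun j _ => hnorm j
    _ = 2 * m * η := by
      rw [Finset.sum_add_distrib, Finset.sum_ite_eq]
      simp
      ring

end Marginals

/-! ### Choice of constants and assembly. -/

section Constants

lemma exists_typicalError_le (d m : ℕ) {η : ℝ} (hη : 0 < η) :
    ∃ θ : ℝ, 0 < θ ∧ typicalError d m θ ≤ η := by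
  have hV0 : 0 ≤ condVar d m := by unfold condVar; positivity
  set K := 2 * √(8 * d + 2) + 2 * condVar d m with hK
  have hK0 : 0 ≤ K := by positivity
  refine ⟨1 + K / η, by positivity, ?_⟩
  have hθ : 1 ≤ 1 + K / η := by have : 0 ≤ K / η := by positivity
                                linarith
  have hKη : K ≤ η * (1 + K / η) := by
    rw [mul_add, mul_div_cancel₀ _ hη.ne']
    linarith
  generalize 1 + K / η = θ at hθ hKη
  have hθ0 : 0 < θ := by linarith
  have h1 : √((8 * d + 2) / θ ^ 2) = √(8 * d + 2) / θ := by
    rw [Real.sqrt_div (by positivity), Real.sqrt_sq hθ0.le]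
  have h2 : condVar d m / θ ^ 2 ≤ condVar d m / θ := by
    apply div_le_div_of_nonneg_left hV0 hθ0
    nlinarith
  calc typicalError d m θ ≤ 2 * (√(8 * d + 2) / θ) + 2 * (condVar d m / θ) := by
        rw [typicalError, h1]; linarith
    _ = K / θ := by rw [hK]; ring
    _ ≤ η := by rwa [div_le_iff₀ hθ0]

/-- Absorbs into the √l term the factor l that the simultaneous control of all positions costs in
the number of samples. -/
lemma natCast_le_exp_sqrt (l : ℕ) : (l : ℝ) ≤ Real.exp (2 * √(l : ℝ)) := by
  have h := Real.add_one_le_exp (√(l : ℝ))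
  have h0 := Real.sqrt_nonneg (l : ℝ)
  calc (l : ℝ) = √(l : ℝ) ^ 2 := (Real.sq_sqrt l.cast_nonneg).symm
    _ ≤ Real.exp (√(l : ℝ)) ^ 2 := pow_le_pow_left₀ h0 (by linarith) 2
    _ = Real.exp (2 * √(l : ℝ)) := by rw [← Real.exp_nat_mul]; norm_num

end Constants

/-- The compression theorem for `l ≥ 1`. -/
lemma exists_compressed_povm {d m : ℕ} (hd : 1 ≤ d) (hm : 1 ≤ m) {ε : ℝ} (hε : 0 < ε) :
    ∃ C : ℝ, ∀ (ρ : Matrix (Fin d) (Fin d) ℂ) (a : Fin m → Matrix (Fin d) (Fin d) ℂ),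
      IsFaithfulState ρ → IsPOVM a → ∀ l : ℕ, 1 ≤ l →
        ∃ (M : ℕ) (A : Fin M → Matrix (Fin l → Fin d) (Fin l → Fin d) ℂ)
          (w : Fin M → Fin l → Fin m),
          IsPOVM A ∧
          (M : ℝ) ≤ Real.exp (l * entropyDefect ρ a + C * √(l : ℝ)) ∧
          ∀ k : Fin l, ∑ j, opNorm (marginal ρ A w k j - a j) ≤ ε := by
  have hm0 : (0 : ℝ) < m := by exact_mod_cast hm
  have hd0 : (0 : ℝ) < d := by exact_mod_cast hd
  -- η is the error allowed per expectation, as `exists_completed` multiplies it by 2m. One half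
  -- goes to the typical resolution, the other to the sampling error 4√δ.
  set η : ℝ := ε / (2 * m) with hη
  have hη0 : 0 < η := by positivity
  obtain ⟨θ, hθ, hθη⟩ := exists_typicalError_le d m (half_pos hη0)
  set δ : ℝ := min 1 ((η / 8) ^ 2) with hδ
  have hδ0 : 0 < δ := lt_min one_pos (by positivity)
  have hδη : 4 * √δ ≤ η / 2 := by
    have : √δ ≤ η / 8 := (Real.sqrt_le_sqrt (min_le_right _ _)).trans_eq
      (Real.sqrt_sq (by positivity))
    linarith
  -- The summand 2 pays for rounding M up and for the completing outcome, as l B ≥ 1.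
  set K : ℝ := (m + 1) * d / δ + 2 with hK
  have hK1 : 1 ≤ K := by
    have : 0 ≤ (m + 1) * d / δ := by positivity
    linarith
  have hcc : 0 ≤ typicalConst d m θ := by unfold typicalConst condConst; positivity
  refine ⟨typicalConst d m θ + 2 + Real.log K, fun ρ a hρ ha l hl => ?_⟩
  have hl1 : (1 : ℝ) ≤ l := by exact_mod_cast hl
  have hρp := hρ.posDef.posSemidef
  have hdef := entropyDefect_nonneg hρp hρ.trace_eq_one ha
  obtain ⟨p, X, hp, hp1, hX, hXB, hG, hmarg⟩ := exists_typicalResolution hl hd hm hρ ha hθ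
  set B := Real.exp (l * entropyDefect ρ a + typicalConst d m θ * √(l : ℝ)) with hB
  have hB1 : 1 ≤ B := Real.one_le_exp (by positivity)
  have hQ0 : 0 < (l : ℝ) * (m + 1) * d * B / δ := by positivity
  set M := ⌈(l : ℝ) * (m + 1) * d * B / δ⌉₊ with hM
  have hM1 : 1 ≤ M := Nat.one_le_ceil_iff.2 hQ0
  have hMge : (l : ℝ) * (m + 1) * d * B ≤ δ * M := by
    have := Nat.le_ceil ((l : ℝ) * (m + 1) * d * B / δ)
    rw [div_le_iff₀ hδ0] at this
    linarith
  have hMle : (M : ℝ) + 1 ≤ l * B * K := by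
    have h1 := (Nat.ceil_lt_add_one hQ0.le).le
    have h2 : (1 : ℝ) ≤ l * B := by nlinarith
    have h3 : l * B * K = l * (m + 1) * d * B / δ + 2 * (l * B) := by rw [hK]; ring
    rw [h3]
    linarith
  obtain ⟨w, A, hA, hA1, hAw⟩ := exists_compressed (K := Fin l) (C := Fin m) p hp hp1 X hX
    (zero_le_one.trans hB1) hXB hG (fun k => tensor (Function.update (fun _ => ρ) k 1))
    (fun k => tensor_posSemidef (update_posSemidef hρp PosSemidef.one k)) (τ := d)
    (fun k => by rw [trace_tensor_update hρ.trace_eq_one]; simp)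
    (fun k j J => if J k = j then 1 else 0)
    (fun k j J => by split_ifs <;> norm_num)
    (fun k j J => by split_ifs <;> norm_num)
    (min_le_left _ _ : δ ≤ 1) M hM1 (by simpa using hMge)
  obtain ⟨A', w', hpovm, hA'⟩ := exists_completed hρ ha hm hA hA1 w hη0.le (by
    intro k j v hv
    have hF := posSemidef_vecMulVec_self_star v
    have hF1 : (vecMulVec v (star v)).trace = 1 := by
      rw [trace_vecMulVec, dotProduct_comm, hv]
    have h1 := hAw k j (tensor (Function.update (fun _ => ρ) k (vecMulVec v (star v))))
      (tensor_posSemidef (update_posSemidef hρp hF k))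
      (by rw [trace_tensor_update hρ.trace_eq_one, hF1])
      (by
        rw [le_iff, ← tensor_update_sub]
        exact tensor_posSemidef (update_posSemidef hρp (le_iff.1 (vecMulVec_le_one hv)) k))
    have h2 := hmarg k j _ hF hF1
    have h3 := abs_sub_le
      (ev (tensor (Function.update (fun _ => ρ) k (vecMulVec v (star v))))
        (∑ μ, (if w μ k = j then 1 else 0 : ℝ) • A μ))
      (ev (tensor (Function.update (fun _ => ρ) k (vecMulVec v (star v))))
        (∑ J, p J • (if J k = j then 1 else 0 : ℝ) • X J))
      (ev (vecMulVec v (star v)) (a j))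
    linarith)
  refine ⟨M + 1, A', w', hpovm, ?_, fun k => (hA' k).trans_eq ?_⟩
  · push_cast
    refine hMle.trans ?_
    have hsq := one_le_sqrt_natCast hl
    have hKe : K ≤ Real.exp (Real.log K * √(l : ℝ)) := by
      calc K = Real.exp (Real.log K) := (Real.exp_log (by linarith)).symm
        _ ≤ _ := Real.exp_le_exp.2 (le_mul_of_one_le_right (Real.log_nonneg hK1) hsq)
    calc l * B * K ≤ Real.exp (2 * √(l : ℝ)) * B * Real.exp (Real.log K * √(l : ℝ)) := by
          gcongr
          exact natCast_le_exp_sqrt l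
      _ = _ := by
          rw [hB, ← Real.exp_add, ← Real.exp_add]
          congr 1
          ring
  · rw [hη]; field_simp

end POVMCompression

end

open POVMCompression in
theorem theorem2 (d m : ℕ) (ε : ℝ) (hε : 0 < ε) :
    ∃ C : ℝ, ∀ (ρ : Matrix (Fin d) (Fin d) ℂ) (a : Fin m → Matrix (Fin d) (Fin d) ℂ),
      IsFaithfulState ρ → IsPOVM a → ∀ l : ℕ,
        ∃ (M : ℕ) (A : Fin M → Matrix (Fin l → Fin d) (Fin l → Fin d) ℂ)
          (w : Fin M → Fin l → Fin m),
          IsPOVM A ∧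
          (M : ℝ) ≤ Real.exp (l * entropyDefect ρ a + C * √(l : ℝ)) ∧
          ∀ k : Fin l, ∑ j, opNorm (marginal ρ A w k j - a j) ≤ ε := by
  rcases Nat.eq_zero_or_pos d with rfl | hd
  · refine ⟨0, fun ρ a hρ => ?_⟩
    have h := hρ.trace_eq_one
    simp at h
  rcases Nat.eq_zero_or_pos m with rfl | hm
  · refine ⟨0, fun ρ a _ ha => ?_⟩
    have h := congrFun (congrFun ha.sum_eq_one ⟨0, hd⟩) ⟨0, hd⟩
    simp at h
  obtain ⟨C, hC⟩ := exists_compressed_povm hd hm hε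
  refine ⟨C, fun ρ a hρ ha l => ?_⟩
  -- For l = 0 the bound on M is exp 0 = 1, met by the trivial measurement with one outcome.
  rcases Nat.eq_zero_or_pos l with rfl | hl
  · exact ⟨1, fun _ => 1, fun _ k => k.elim0, ⟨fun _ => Matrix.PosSemidef.one, by simp⟩, by simp,
      fun k => k.elim0⟩
  · exact hC ρ a hρ ha l hl
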